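/- Let $\mu$ be a probability distribution on $\mathbb{R}$ with mean zero and finite second moment which satisfies the following condition (H): there are $M>0$ and $q\in(0,1)$ such that a random variable $\xi$ with law $\mu$ satisfies \[ \sup_{u\in\mathbb{R}}\mathbb{P}(|\xi-u|\le 1)\le 1-q\qquad\text{and}\qquad \mathbb{P}(|\xi|>M)\le q/2 . \] Let $\xi_0,\xi_1,\dots$ be i.i.d. real random variables with law $\mu$, and let $\mathcal{C}_n$ be the $n\times n$ random circulant matrix with first row $(\xi_0,\dots,\xi_{n-1})$, i.e. the matrix with entries $(\mathcal{C}_n)_{i,j}=\xi_{(j-i)\bmod n}$. For a square real matrix $A$ let $\sigma_{\max}(A)$ and $\sigma_{\min}(A)$ be its largest and smallest singular values, and let $\kappa(A)=\sigma_{\max}(A)/\sigma_{\min}(A)$ be its condition number, with $\kappa(A)=\infty$ if $A$ is singular. (1) Suppose in addition that $\mu$ has positive variance and that its moment generating function is finite on an open interval around $0$. Then there are constants $C_0,C_1>0$ and a real sequence $\delta_n\to 0$, depending only on $\mu$, such that for every $\varepsilon>0$ and every $\rho\in(0,1/4)$, for all sufficiently large $n$ (depending on $\mu,\varepsilon,\rho$),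 \[ \mathbb{P}\left(\kappa(\mathcal{C}_n)\le \frac{C_0}{\varepsilon}\,n^{\rho+1/2}(\log n)^{1/2}\right)\ \ge\ 1-C_1\left((\varepsilon^2+\varepsilon)\,n^{-2\rho}+n^{-1/2+\delta_n}\right). \] (2) Without the additional assumptions of (1), there are constants $C_0,C_2>0$, depending only on $\mu$, such that for every $\varepsilon>0$ and every $\rho\in(0,1/4)$, for all sufficiently large $n$ (depending on $\mu,\varepsilon,\rho$), \[ \mathbb{P}\left(\kappa(\mathcal{C}_n)\le \frac{C_0}{\varepsilon}\,n^{\rho+1/2}\log n\right)\ \ge\ 1-C_2\left((\varepsilon^2+\varepsilon)\,n^{-2\rho}+(\log n)^{-1/2}\right). \] -/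

import Mathlib

open MeasureTheory ProbabilityTheory Filter
open scoped ENNReal Topology

noncomputable section

/-- Condition (H) for a real random variable with law `μ`: for some `M > 0` and `q ∈ (0,1)`,
`sup_u P(|ξ - u| ≤ 1) ≤ 1 - q` and `P(|ξ| > M) ≤ q / 2`. -/
def ConditionH (μ : Measure ℝ) : Prop :=
  ∃ M q : ℝ, 0 < M ∧ 0 < q ∧ q < 1 ∧
    (∀ u : ℝ, μ.real {x | |x - u| ≤ 1} ≤ 1 - q) ∧ μ.real {x | M < |x|} ≤ q / 2

/-- The moment generating function of the law `μ` is finite on an open interval around zero. -/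
def HasMGFNearZero (μ : Measure ℝ) : Prop :=
  ∃ a : ℝ, 0 < a ∧ ∀ t ∈ Set.Ioo (-a) a, Integrable (fun x : ℝ => Real.exp (t * x)) μ

/-- `ξ 0, ξ 1, …` are independent random variables on `(Ω, P)`, all with law `μ`. -/
def IsIID {Ω : Type*} [MeasurableSpace Ω] (P : Measure Ω) (μ : Measure ℝ)
    (ξ : ℕ → Ω → ℝ) : Prop :=
  (∀ j, HasLaw (ξ j) μ P) ∧ iIndepFun ξ P

/-- The circulant matrix with first row `x 0, …, x (n-1)`; its `(i, j)` entry is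
`x ((j - i) mod n)`. -/
def circulantMatrix (n : ℕ) (x : ℕ → ℝ) : Matrix (Fin n) (Fin n) ℝ :=
  Matrix.of fun i j => x ((j - i : Fin n) : ℕ)

/-- The largest singular value (Mathlib indexes the singular values decreasingly from `0`). -/
def sigmaMax {n : ℕ} (A : Matrix (Fin n) (Fin n) ℝ) : ℝ :=
  (Matrix.toEuclideanLin A).singularValues 0

/-- The smallest of the `n` singular values. -/
def sigmaMin {n : ℕ} (A : Matrix (Fin n) (Fin n) ℝ) : ℝ :=
  (Matrix.toEuclideanLin A).singularValues (n - 1)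

open Classical in
/-- The condition number `σ_max / σ_min`, with value `∞` on singular matrices. -/
def conditionNumber {n : ℕ} (A : Matrix (Fin n) (Fin n) ℝ) : ℝ≥0∞ :=
  if sigmaMin A = 0 then ⊤ else ENNReal.ofReal (sigmaMax A / sigmaMin A)

end

/-! The discrete Fourier transform diagonalises a circulant matrix, so its singular values are the
moduli `|G(z)|` of the random polynomial `G(z) = ∑ ξ_j z^j` at the `n`-th roots of unity. It
suffices that, off an event of small probability, all these moduli lie between `a = ε n^(-ρ)` and a
constant times `√n √(log n)` (or `√n log n`); then `conditionNumber_circulantMatrix_le` bounds `κ`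
by the ratio.

For the lower bound, an Esseen inequality in the plane reduces `P(|G(z)| ≤ T)` to an integral of the
characteristic function of `G(z)`. Independence and symmetrisation bound the latter by the
exponential of `-∑ (1 - cos (Re (w z^j)))`, with `w` a frequency times a difference `ξ - ξ'`;
condition (H) keeps that difference in `[1, M]` with positive probability. The core is
`min_sq_le_sum_one_sub_cos`: if `z` has order `d ≥ 3` and `|w| ≤ d / (2π)`, the sum is at least of
order `n min(|w|², 1)`. This permits radius `T = t + O(1/d)` and gives probability `O(T² / n)` plus
an exponentially small term. At most `d` of the roots have order `d`, so a union bound costs `O(t² +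
(log n) / n)`. The at most two real roots, `z = ±1`, carry a one-dimensional sum and cost
`O(n^(-1/2))`.

The upper bound is a Chernoff estimate in four directions with a union bound over the roots. It
applies directly under exponential moments; with two moments it is applied to the variables
truncated at `√n`, and the remainder is handled by Markov's inequality. -/

/-! ### Circulant matrices and the discrete Fourier transform -/

/-- The root of unity `exp (2πi k / n)`. -/
noncomputable def rootExp (n k : ℕ) : ℂ := Complex.exp (2 * Real.pi * Complex.I * k / n)

/-- The value at `rootExp n k` of the polynomial with coefficients `x 0, …, x (n - 1)`. -/
noncomputable def dftCoeff (n : ℕ) (x : ℕ → ℝ) (k : ℕ) : ℂ :=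
  ∑ j ∈ Finset.range n, (x j : ℂ) * rootExp n k ^ j

lemma rootExp_eq_pow (n k : ℕ) : rootExp n k = rootExp n 1 ^ k := by
  rw [rootExp, rootExp, ← Complex.exp_nat_mul]
  congr 1
  push_cast
  ring

lemma isPrimitiveRoot_rootExp_one {n : ℕ} (hn : n ≠ 0) : IsPrimitiveRoot (rootExp n 1) n := by
  have := Complex.isPrimitiveRoot_exp n hn
  simpa [rootExp] using this

lemma rootExp_pow_self {n : ℕ} (hn : n ≠ 0) (k : ℕ) : rootExp n k ^ n = 1 := by
  rw [rootExp_eq_pow, ← pow_mul, mul_comm, pow_mul, (isPrimitiveRoot_rootExp_one hn).pow_eq_one,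
    one_pow]

lemma norm_rootExp (n k : ℕ) : ‖rootExp n k‖ = 1 := by
  have : rootExp n k = Complex.exp ((2 * Real.pi * k / n : ℝ) * Complex.I) := by
    rw [rootExp]; congr 1; push_cast; ring
  rw [this, Complex.norm_exp_ofReal_mul_I]

lemma rootExp_mul_conj (n k : ℕ) : rootExp n k * (starRingEnd ℂ) (rootExp n k) = 1 := by
  rw [Complex.mul_conj, Complex.normSq_eq_norm_sq, norm_rootExp]; simp

lemma sum_rootExp_pow_mul_conj {n : ℕ} (hn : n ≠ 0) (i j : Fin n) :
    ∑ k ∈ Finset.range n, rootExp n k ^ (i : ℕ) * (starRingEnd ℂ) (rootExp n k) ^ (j : ℕ)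
      = if i = j then (n : ℂ) else 0 := by
  have hprim := isPrimitiveRoot_rootExp_one hn
  set ζ := rootExp n 1 with hζ
  have hz : ζ * (starRingEnd ℂ) ζ = 1 := rootExp_mul_conj n 1
  have hterm : ∀ k, rootExp n k ^ (i : ℕ) * (starRingEnd ℂ) (rootExp n k) ^ (j : ℕ)
      = (ζ ^ (i : ℕ) * (starRingEnd ℂ) ζ ^ (j : ℕ)) ^ k := by
    intro k
    rw [rootExp_eq_pow, map_pow]
    ring
  simp_rw [hterm]
  split_ifs with h
  · subst h
    rw [← mul_pow, hz]; simp
  · set y := ζ ^ (i : ℕ) * (starRingEnd ℂ) ζ ^ (j : ℕ)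
    have hy : y ≠ 1 := by
      intro hy
      have h1 : ζ ^ (i : ℕ) = ζ ^ (j : ℕ) := by
        calc ζ ^ (i : ℕ) = ζ ^ (i : ℕ) * (ζ * (starRingEnd ℂ) ζ) ^ (j : ℕ) := by rw [hz]; simp
          _ = y * ζ ^ (j : ℕ) := by simp only [y]; ring
          _ = _ := by rw [hy, one_mul]
      exact h (Fin.ext (hprim.pow_inj i.2 j.2 h1))
    have hyn : y ^ n = 1 := by
      have h1 : ζ ^ n = 1 := hprim.pow_eq_one
      have h2 : (starRingEnd ℂ) ζ ^ n = 1 := by rw [← map_pow, h1, map_one]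
      calc y ^ n = (ζ ^ n) ^ (i : ℕ) * ((starRingEnd ℂ) ζ ^ n) ^ (j : ℕ) := by
            simp only [y]; ring
        _ = 1 := by rw [h1, h2]; simp
    rw [geom_sum_eq hy, hyn]; simp

/-- Parseval's identity for the discrete Fourier transform. -/
lemma sum_norm_sq_dft {n : ℕ} (hn : n ≠ 0) (v : Fin n → ℝ) :
    ∑ k ∈ Finset.range n, ‖∑ i : Fin n, (v i : ℂ) * rootExp n k ^ (i : ℕ)‖ ^ 2
      = n * ∑ i, v i ^ 2 := by
  have key : ∑ k ∈ Finset.range n, ((‖∑ i : Fin n, (v i : ℂ) * rootExp n k ^ (i : ℕ)‖ ^ 2 : ℝ) : ℂ)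
      = n * ∑ i, (v i : ℂ) ^ 2 := by
    have h1 : ∀ k, ((‖∑ i : Fin n, (v i : ℂ) * rootExp n k ^ (i : ℕ)‖ ^ 2 : ℝ) : ℂ)
        = ∑ i : Fin n, ∑ j : Fin n, (v i : ℂ) * v j *
          (rootExp n k ^ (i : ℕ) * (starRingEnd ℂ) (rootExp n k) ^ (j : ℕ)) := by
      intro k
      rw [← Complex.normSq_eq_norm_sq, ← Complex.mul_conj, map_sum, Finset.sum_mul_sum]
      refine Finset.sum_congr rfl fun i _ => Finset.sum_congr rfl fun j _ => ?_
      rw [map_mul, map_pow, Complex.conj_ofReal]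
      ring
    simp_rw [h1]
    rw [Finset.sum_comm, Finset.mul_sum]
    refine Finset.sum_congr rfl fun i _ => ?_
    rw [Finset.sum_comm]
    simp_rw [← Finset.mul_sum, sum_rootExp_pow_mul_conj hn]
    simp
    ring
  exact_mod_cast key

lemma rootExp_pow_sub {n : ℕ} (hn : n ≠ 0) (k : ℕ) (j m : Fin n) :
    rootExp n k ^ ((j - m : Fin n) : ℕ)
      = rootExp n k ^ (j : ℕ) * (starRingEnd ℂ) (rootExp n k) ^ (m : ℕ) := by
  have h1 := rootExp_pow_self hn k
  have hz := rootExp_mul_conj n k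
  set ζ := rootExp n k
  have h2 : ζ ^ ((j - m : Fin n) : ℕ) = ζ ^ (n - (m : ℕ) + j) := by
    rw [Fin.sub_def]
    exact (pow_eq_pow_mod _ h1).symm
  have h3 : ζ ^ (n - (m : ℕ)) = (starRingEnd ℂ) ζ ^ (m : ℕ) := by
    calc ζ ^ (n - (m : ℕ)) = ζ ^ (n - (m : ℕ)) * (ζ * (starRingEnd ℂ) ζ) ^ (m : ℕ) := by
          rw [hz]; simp
      _ = ζ ^ (n - (m : ℕ) + m) * (starRingEnd ℂ) ζ ^ (m : ℕ) := by rw [pow_add]; ring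
      _ = _ := by rw [Nat.sub_add_cancel m.2.le, h1, one_mul]
  rw [h2, pow_add, h3, mul_comm]

/-- The first-row convention makes the matrix act as a correlation rather than a convolution; hence
the conjugate on the multiplier. -/
lemma dft_circulantMatrix_mulVec {n : ℕ} (hn : n ≠ 0) (x : ℕ → ℝ) (v : Fin n → ℝ) (k : ℕ) :
    ∑ i : Fin n, (((circulantMatrix n x).mulVec v i : ℝ) : ℂ) * rootExp n k ^ (i : ℕ)
      = (starRingEnd ℂ) (dftCoeff n x k) * ∑ i : Fin n, (v i : ℂ) * rootExp n k ^ (i : ℕ) := by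
  have : NeZero n := ⟨hn⟩
  have hcoeff : (starRingEnd ℂ) (dftCoeff n x k)
      = ∑ m : Fin n, (x m : ℂ) * (starRingEnd ℂ) (rootExp n k) ^ (m : ℕ) := by
    rw [dftCoeff, map_sum, Finset.sum_range]
    simp
  have hl : ∀ i : Fin n, (((circulantMatrix n x).mulVec v i : ℝ) : ℂ) * rootExp n k ^ (i : ℕ)
      = ∑ j : Fin n, (x ((j - i : Fin n) : ℕ) : ℂ) * v j * rootExp n k ^ (i : ℕ) := by
    intro i
    simp [Matrix.mulVec, dotProduct, circulantMatrix, Finset.sum_mul]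
  simp_rw [hl]
  rw [Finset.sum_comm, hcoeff, Finset.mul_sum]
  refine Finset.sum_congr rfl fun j _ => ?_
  rw [← (Equiv.subLeft j).sum_comp, Finset.sum_mul]
  refine Finset.sum_congr rfl fun m _ => ?_
  simp only [Equiv.subLeft_apply, sub_sub_cancel]
  rw [rootExp_pow_sub hn]
  ring

/-- Parseval applied to the image vector. Uniform bounds on the multipliers thus bound every
singular value, with no need to compute the spectrum exactly. -/
lemma norm_sq_toEuclideanLin_circulantMatrix {n : ℕ} (hn : n ≠ 0) (x : ℕ → ℝ)
    (v : EuclideanSpace ℝ (Fin n)) :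
    n * ‖Matrix.toEuclideanLin (circulantMatrix n x) v‖ ^ 2 = ∑ k ∈ Finset.range n,
      ‖dftCoeff n x k‖ ^ 2 * ‖∑ i : Fin n, (v i : ℂ) * rootExp n k ^ (i : ℕ)‖ ^ 2 := by
  have h := sum_norm_sq_dft hn ((circulantMatrix n x).mulVec v.ofLp)
  simp_rw [dft_circulantMatrix_mulVec hn, norm_mul, mul_pow, RCLike.norm_conj] at h
  rw [h, EuclideanSpace.norm_sq_eq]
  simp [Matrix.toLpLin_apply]

lemma norm_sq_eq_singularValues_sq {n i : ℕ} (hi : i < n) (A : Matrix (Fin n) (Fin n) ℝ) :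
    ∃ v : EuclideanSpace ℝ (Fin n), v ≠ 0 ∧
      ‖Matrix.toEuclideanLin A v‖ ^ 2 = (Matrix.toEuclideanLin A).singularValues i ^ 2 * ‖v‖ ^ 2 := by
  set T := Matrix.toEuclideanLin A
  have h := T.hasEigenvalue_adjoint_comp_self_sq_singularValues (n := i) (by simpa using hi)
  obtain ⟨v, hv⟩ := h.exists_hasEigenvector
  refine ⟨v, hv.2, ?_⟩
  have h1 := hv.apply_eq_smul
  rw [← real_inner_self_eq_norm_sq, ← real_inner_self_eq_norm_sq,
    ← LinearMap.adjoint_inner_left, ← LinearMap.comp_apply, h1, real_inner_smul_left]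
  simp

lemma sigmaMax_circulantMatrix_le {n : ℕ} (hn : n ≠ 0) (x : ℕ → ℝ) {b : ℝ} (hb : 0 ≤ b)
    (h : ∀ k ∈ Finset.range n, ‖dftCoeff n x k‖ ≤ b) : sigmaMax (circulantMatrix n x) ≤ b := by
  obtain ⟨v, hv, hvs⟩ := norm_sq_eq_singularValues_sq (Nat.pos_of_ne_zero hn) (circulantMatrix n x)
  have hn' : (0 : ℝ) < n := by exact_mod_cast Nat.pos_of_ne_zero hn
  have h1 : n * ‖Matrix.toEuclideanLin (circulantMatrix n x) v‖ ^ 2 ≤ n * (b ^ 2 * ‖v‖ ^ 2) := by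
    rw [norm_sq_toEuclideanLin_circulantMatrix hn, EuclideanSpace.norm_sq_eq]
    have := sum_norm_sq_dft hn v.ofLp
    simp only [Real.norm_eq_abs, sq_abs]
    rw [mul_left_comm, ← this, Finset.mul_sum]
    refine Finset.sum_le_sum fun k hk => ?_
    exact mul_le_mul_of_nonneg_right (pow_le_pow_left₀ (by positivity) (h k hk) 2) (by positivity)
  have h2 := le_of_mul_le_mul_left h1 hn'
  rw [hvs] at h2
  have h3 := le_of_mul_le_mul_right h2 (by positivity)
  exact le_of_sq_le_sq h3 hb

lemma le_singularValues_circulantMatrix {n i : ℕ} (hi : i < n) (x : ℕ → ℝ) {b : ℝ} (hb : 0 ≤ b)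
    (h : ∀ k ∈ Finset.range n, b ≤ ‖dftCoeff n x k‖) :
    b ≤ (Matrix.toEuclideanLin (circulantMatrix n x)).singularValues i := by
  have hn : n ≠ 0 := by omega
  obtain ⟨v, hv, hvs⟩ := norm_sq_eq_singularValues_sq hi (circulantMatrix n x)
  have hn' : (0 : ℝ) < n := by exact_mod_cast Nat.pos_of_ne_zero hn
  have h1 : n * (b ^ 2 * ‖v‖ ^ 2) ≤ n * ‖Matrix.toEuclideanLin (circulantMatrix n x) v‖ ^ 2 := by
    rw [norm_sq_toEuclideanLin_circulantMatrix hn, EuclideanSpace.norm_sq_eq]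
    have := sum_norm_sq_dft hn v.ofLp
    simp only [Real.norm_eq_abs, sq_abs]
    rw [mul_left_comm, ← this, Finset.mul_sum]
    refine Finset.sum_le_sum fun k hk => ?_
    exact mul_le_mul_of_nonneg_right (pow_le_pow_left₀ (by positivity) (h k hk) 2) (by positivity)
  have h2 := le_of_mul_le_mul_left h1 hn'
  rw [hvs] at h2
  have h3 := le_of_mul_le_mul_right h2 (by positivity)
  exact le_of_sq_le_sq h3
    (LinearMap.singularValues_nonneg (Matrix.toEuclideanLin (circulantMatrix n x)) i)

lemma le_sigmaMin_circulantMatrix {n : ℕ} (hn : n ≠ 0) (x : ℕ → ℝ) {b : ℝ} (hb : 0 ≤ b)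
    (h : ∀ k ∈ Finset.range n, b ≤ ‖dftCoeff n x k‖) : b ≤ sigmaMin (circulantMatrix n x) := by
  rw [sigmaMin]
  exact le_singularValues_circulantMatrix (Nat.sub_one_lt hn) x hb h

lemma conditionNumber_circulantMatrix_le {n : ℕ} (hn : n ≠ 0) (x : ℕ → ℝ) {a b : ℝ} (ha : 0 < a)
    (hb : 0 ≤ b) (h : ∀ k ∈ Finset.range n, a ≤ ‖dftCoeff n x k‖ ∧ ‖dftCoeff n x k‖ ≤ b) :
    conditionNumber (circulantMatrix n x) ≤ ENNReal.ofReal (b / a) := by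
  have h1 := le_sigmaMin_circulantMatrix hn x ha.le fun k hk => (h k hk).1
  have h2 := sigmaMax_circulantMatrix_le hn x hb fun k hk => (h k hk).2
  rw [conditionNumber, if_neg (ha.trans_le h1).ne']
  exact ENNReal.ofReal_le_ofReal (div_le_div₀ hb h2 ha h1)

/-! ### Cosine sums along powers of a root of unity -/

lemma sum_range_pow_add {M : Type*} [AddCommGroup M] {z : ℂ} {n : ℕ} (hz : z ^ n = 1) (f : ℂ → M)
    (m : ℕ) : ∑ j ∈ Finset.range n, f (z ^ (j + m)) = ∑ j ∈ Finset.range n, f (z ^ j) := by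
  induction m with
  | zero => simp
  | succ m ih =>
    rw [← ih]
    have h1 := Finset.sum_range_succ (fun j => f (z ^ (j + m))) n
    have h2 := Finset.sum_range_succ' (fun j => f (z ^ (j + m))) n
    rw [h1] at h2
    have h3 : z ^ (n + m) = z ^ (0 + m) := by rw [pow_add, hz]; simp
    rw [h3] at h2
    have h4 := add_right_cancel h2
    rw [h4]
    exact Finset.sum_congr rfl fun j _ => by rw [add_right_comm, add_assoc]

/-- Since `(Re u)² = |u|²/2 + Re(u²)/2`, the fluctuating part is a geometric sum in `z²`, which
vanishes because `z² ≠ 1`. -/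
lemma sum_re_mul_pow_sq {z : ℂ} {n : ℕ} (hz : z ^ n = 1) (hz1 : ‖z‖ = 1) (hz2 : z ^ 2 ≠ 1) (w : ℂ) :
    ∑ j ∈ Finset.range n, (w * z ^ j).re ^ 2 = n * ‖w‖ ^ 2 / 2 := by
  have h1 : ∀ j, (w * z ^ j).re ^ 2 = ‖w‖ ^ 2 / 2 + (w ^ 2 * (z ^ 2) ^ j).re / 2 := by
    intro j
    have e1 : ‖w * z ^ j‖ ^ 2 = ‖w‖ ^ 2 := by rw [norm_mul, norm_pow, hz1]; simp
    have e2 : w ^ 2 * (z ^ 2) ^ j = (w * z ^ j) ^ 2 := by ring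
    rw [e2, ← e1, ← Complex.normSq_eq_norm_sq, Complex.normSq_apply]
    generalize w * z ^ j = u
    rw [sq u, Complex.mul_re]
    ring
  simp_rw [h1]
  rw [Finset.sum_add_distrib, ← Finset.sum_div, ← Finset.sum_div, ← Complex.re_sum, ← Finset.mul_sum,
    geom_sum_eq hz2, ← pow_mul, mul_comm 2 n, pow_mul, hz]
  simp

lemma two_mul_sq_div_le_one_sub_cos {y : ℝ} (hy : |y| ≤ Real.pi) :
    2 / Real.pi ^ 2 * y ^ 2 ≤ 1 - Real.cos y := by
  linarith [Real.cos_le_one_sub_mul_cos_sq hy]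

lemma sum_re_sq_le_sum_one_sub_cos {z : ℂ} (n : ℕ) (hz1 : ‖z‖ = 1) {w : ℂ} (hw : ‖w‖ ≤ Real.pi) :
    2 / Real.pi ^ 2 * ∑ j ∈ Finset.range n, (w * z ^ j).re ^ 2
      ≤ ∑ j ∈ Finset.range n, (1 - Real.cos (w * z ^ j).re) := by
  rw [Finset.mul_sum]
  refine Finset.sum_le_sum fun j _ => two_mul_sq_div_le_one_sub_cos ?_
  refine (Complex.abs_re_le_norm _).trans ?_
  rw [norm_mul, norm_pow, hz1]
  simpa using hw

/-- As `1 - cos θ = |e^(iθ) - 1|² / 2`, this is the triangle inequality through the point `1`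
followed by `(x + y)² ≤ 2x² + 2y²`. -/
lemma one_sub_cos_sub_le (a b : ℝ) :
    1 - Real.cos (a - b) ≤ 2 * (1 - Real.cos a) + 2 * (1 - Real.cos b) := by
  rw [Real.cos_sub]
  nlinarith [Real.sin_sq_add_cos_sq a, Real.sin_sq_add_cos_sq b, sq_nonneg (Real.sin a + Real.sin b),
    sq_nonneg (Real.cos a + Real.cos b - 2)]

lemma norm_rootExp_one_sub_one_le (d : ℕ) : ‖rootExp d 1 - 1‖ ≤ 2 * Real.pi / d := by
  have : rootExp d 1 = Complex.exp (Complex.I * (2 * Real.pi / d : ℝ)) := by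
    rw [rootExp]; congr 1; push_cast; ring
  rw [this]
  refine (Real.norm_exp_I_mul_ofReal_sub_one_le).trans ?_
  rw [Real.norm_eq_abs, abs_of_nonneg (by positivity)]

/-- Otherwise all powers would have positive real part, while their sum over a period is zero. -/
lemma exists_one_le_norm_rootExp_pow_sub_one {d : ℕ} (hd : 2 ≤ d) :
    ∃ l : ℕ, 1 ≤ ‖rootExp d 1 ^ l - 1‖ := by
  by_contra! h
  have hs := (isPrimitiveRoot_rootExp_one (n := d) (by omega)).geom_sum_eq_zero (by omega)
  have h1 : ∀ l, 0 < (rootExp d 1 ^ l).re := by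
    intro l
    have := (Complex.abs_re_le_norm _).trans_lt (h l)
    rw [Complex.sub_re, Complex.one_re, abs_lt] at this
    linarith [this.1]
  have h2 : 0 < ∑ l ∈ Finset.range d, (rootExp d 1 ^ l).re :=
    Finset.sum_pos (fun l _ => h1 l) ⟨0, by simp; omega⟩
  rw [← Complex.re_sum, hs] at h2
  simp at h2

/-- Some power of `z` is `ζ = exp(2πi/d)`. Along `l = 0, 1, …` the quantity `|w (ζ^l - 1)|` starts
at zero, moves by at most `2π|w|/d ≤ 1` per step and reaches `1`; at the first such `l` it is at
most `2`. -/
lemma exists_norm_mul_pow_sub_one_mem_Icc {z w : ℂ} (hd : 2 ≤ orderOf z) (hw : 1 ≤ ‖w‖)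
    (hwd : 2 * Real.pi * ‖w‖ ≤ orderOf z) :
    ∃ m : ℕ, 1 ≤ ‖w * (z ^ m - 1)‖ ∧ ‖w * (z ^ m - 1)‖ ≤ 2 := by
  classical
  set d := orderOf z with hdz
  have hd0 : d ≠ 0 := by omega
  have : NeZero d := ⟨hd0⟩
  have hprim := isPrimitiveRoot_rootExp_one hd0
  obtain ⟨a, -, ha⟩ := (IsPrimitiveRoot.orderOf z).eq_pow_of_pow_eq_one hprim.pow_eq_one
  have hex : ∃ l : ℕ, 1 ≤ ‖w * (rootExp d 1 ^ l - 1)‖ := by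
    obtain ⟨l, hl⟩ := exists_one_le_norm_rootExp_pow_sub_one hd
    refine ⟨l, ?_⟩
    rw [norm_mul]
    nlinarith
  obtain ⟨l, hspec, hmin⟩ : ∃ l : ℕ, 1 ≤ ‖w * (rootExp d 1 ^ l - 1)‖ ∧
      ∀ l' < l, ‖w * (rootExp d 1 ^ l' - 1)‖ < 1 :=
    ⟨Nat.find hex, Nat.find_spec hex, fun l' h => not_le.1 (Nat.find_min hex h)⟩
  refine ⟨a * l, ?_⟩
  rw [pow_mul, ha]
  refine ⟨hspec, ?_⟩
  cases l with
  | zero =>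
    simp only [pow_zero, sub_self, mul_zero, norm_zero] at hspec
    linarith
  | succ l' =>
    have h1 := hmin l' (Nat.lt_succ_self l')
    have h2 : w * (rootExp d 1 ^ (l' + 1) - 1)
        = w * (rootExp d 1 ^ l' - 1) * rootExp d 1 + w * (rootExp d 1 - 1) := by ring
    have h3 : ‖w * (rootExp d 1 - 1)‖ ≤ 1 := by
      rw [norm_mul]
      have hdpos : (0 : ℝ) < d := by positivity
      calc ‖w‖ * ‖rootExp d 1 - 1‖ ≤ ‖w‖ * (2 * Real.pi / d) := by
            gcongr; exact norm_rootExp_one_sub_one_le d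
        _ = 2 * Real.pi * ‖w‖ / d := by ring
        _ ≤ 1 := by rw [div_le_one hdpos]; exact hwd
    rw [h2]
    refine (norm_add_le _ _).trans ?_
    rw [norm_mul _ (rootExp d 1), norm_rootExp]
    linarith

/-- The points `Re (w z ^ j)` cannot cluster near `2πℤ` as long as `|w|` is small compared to the
order of the root of unity `z`. -/
lemma min_sq_le_sum_one_sub_cos {z w : ℂ} {n : ℕ} (hz : z ^ n = 1) (hz1 : ‖z‖ = 1)
    (hd : 3 ≤ orderOf z) (hwd : 2 * Real.pi * ‖w‖ ≤ orderOf z) :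
    n / (4 * Real.pi ^ 2) * min (‖w‖ ^ 2) 1
      ≤ ∑ j ∈ Finset.range n, (1 - Real.cos (w * z ^ j).re) := by
  have hπ := Real.pi_gt_three
  have hz2 : z ^ 2 ≠ 1 := by
    intro h
    have := Nat.le_of_dvd (by norm_num) (orderOf_dvd_of_pow_eq_one h)
    omega
  have hquad : ∀ u : ℂ, ‖u‖ ≤ Real.pi →
      n / Real.pi ^ 2 * ‖u‖ ^ 2 ≤ ∑ j ∈ Finset.range n, (1 - Real.cos (u * z ^ j).re) := by
    intro u hu
    have := sum_re_sq_le_sum_one_sub_cos n hz1 hu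
    rw [sum_re_mul_pow_sq hz hz1 hz2] at this
    refine le_of_eq_of_le ?_ this
    ring
  rcases le_total ‖w‖ 1 with hw | hw
  · refine le_trans ?_ (hquad w (by linarith))
    have h1 : (n : ℝ) / (4 * Real.pi ^ 2) ≤ n / Real.pi ^ 2 := by
      gcongr; nlinarith
    exact mul_le_mul h1 (min_le_left _ _) (by positivity) (by positivity)
  -- For large `w` the quadratic bound fails, so `w` is replaced by `w (z^m - 1)`, of norm in `[1,
  -- 2]`. Its sum is controlled by the original one because a shift by `m` permutes the points `w
  -- z^j`.
  · obtain ⟨m, hm1, hm2⟩ := exists_norm_mul_pow_sub_one_mem_Icc (by omega) hw hwd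
    have h1 := hquad _ (hm2.trans (by linarith))
    have h2 : ∑ j ∈ Finset.range n, (1 - Real.cos (w * (z ^ m - 1) * z ^ j).re)
        ≤ 4 * ∑ j ∈ Finset.range n, (1 - Real.cos (w * z ^ j).re) := by
      calc _ ≤ ∑ j ∈ Finset.range n, (2 * (1 - Real.cos (w * z ^ (j + m)).re)
              + 2 * (1 - Real.cos (w * z ^ j).re)) := by
            refine Finset.sum_le_sum fun j _ => ?_
            have e : w * (z ^ m - 1) * z ^ j = w * z ^ (j + m) - w * z ^ j := by
              rw [pow_add]; ring
            rw [e, Complex.sub_re]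
            exact one_sub_cos_sub_le _ _
        _ = _ := by
            rw [Finset.sum_add_distrib, ← Finset.mul_sum, ← Finset.mul_sum,
              sum_range_pow_add hz (fun u => 1 - Real.cos (w * u).re)]
            ring
    have h3 : (n : ℝ) / Real.pi ^ 2 ≤ n / Real.pi ^ 2 * ‖w * (z ^ m - 1)‖ ^ 2 :=
      le_mul_of_one_le_right (by positivity) (one_le_pow₀ hm1)
    have h4 : n / (4 * Real.pi ^ 2) * min (‖w‖ ^ 2) 1 ≤ n / (4 * Real.pi ^ 2) :=
      mul_le_of_le_one_right (by positivity) (min_le_right _ _)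
    have h5 : (n : ℝ) / (4 * Real.pi ^ 2) = n / Real.pi ^ 2 / 4 := by ring
    linarith

/-! ### Esseen's inequality in the plane -/

/-- The uniform distribution on `[-1, 1]`. -/
noncomputable def uniformMeasure : Measure ℝ := (2⁻¹ : ℝ≥0∞) • volume.restrict (Set.Ioc (-1) 1)

instance : IsProbabilityMeasure uniformMeasure := by
  constructor
  rw [uniformMeasure, Measure.smul_apply, Measure.restrict_apply_univ, Real.volume_Ioc, smul_eq_mul]
  norm_num
  exact ENNReal.inv_mul_cancel (by simp) (by simp)

/-- The law of the sum of two independent uniform variables on `[-1, 1]`. -/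
noncomputable def triangleMeasure : Measure ℝ := uniformMeasure ∗ uniformMeasure

instance : IsProbabilityMeasure triangleMeasure := by
  rw [triangleMeasure]; infer_instance

lemma charFun_uniformMeasure (t : ℝ) : charFun uniformMeasure t = Real.sinc t := by
  rcases eq_or_ne t 0 with rfl | ht
  · simp
  rw [charFun_apply_real, uniformMeasure, integral_smul_measure,
    ← intervalIntegral.integral_of_le (by norm_num)]
  have h := integral_exp_mul_I_eq_sinc t
  have h2 := intervalIntegral.integral_comp_mul_left (a := -1) (b := 1)
    (fun x : ℝ => Complex.exp (x * Complex.I)) ht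
  simp only [mul_neg, mul_one, Complex.ofReal_mul] at h2
  have ht' : (t : ℂ) ≠ 0 := by exact_mod_cast ht
  rw [h2, h]
  simp only [ENNReal.toReal_inv, ENNReal.toReal_ofNat, Complex.real_smul]
  push_cast
  field_simp

/-- The convolution square makes the transform nonnegative, so it can majorise an indicator, while
the law keeps a compact support and a bounded density. -/
lemma charFun_triangleMeasure (t : ℝ) : charFun triangleMeasure t = (Real.sinc t ^ 2 : ℝ) := by
  rw [triangleMeasure, charFun_conv, charFun_uniformMeasure]
  push_cast
  ring

lemma half_le_sinc_sq {x : ℝ} (hx : |x| ≤ 1) : 1 / 2 ≤ Real.sinc x ^ 2 := by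
  have hpos : ∀ y : ℝ, 0 < y → y ≤ 1 → 1 / 2 ≤ Real.sinc y ^ 2 := by
    intro y hy hy1
    have h := Real.sin_gt_sub_cube hy
    rw [Real.sinc_of_ne_zero hy.ne']
    have h2 : 5 / 6 ≤ Real.sin y / y := by
      rw [le_div_iff₀ hy]
      nlinarith [mul_nonneg hy.le (sub_nonneg.2 hy1), mul_nonneg (mul_nonneg hy.le hy.le) (sub_nonneg.2 hy1)]
    nlinarith
  rcases lt_trichotomy x 0 with h | h | h
  · rw [← Real.sinc_neg]
    exact hpos (-x) (by linarith) (by linarith [(abs_le.1 hx).1])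
  · subst h; norm_num
  · exact hpos x h (abs_le.1 hx).2

lemma ae_abs_le_uniformMeasure : ∀ᵐ u ∂uniformMeasure, |u| ≤ 1 := by
  rw [uniformMeasure]
  refine Measure.ae_smul_measure ?_ _
  filter_upwards [ae_restrict_mem measurableSet_Ioc] with u hu
  exact abs_le.2 ⟨hu.1.le, hu.2⟩

lemma ae_abs_le_triangleMeasure : ∀ᵐ u ∂triangleMeasure, |u| ≤ 2 := by
  rw [triangleMeasure, Measure.conv,
    ae_map_iff (by fun_prop) (measurableSet_le (by fun_prop) (by fun_prop))]
  filter_upwards [Measure.quasiMeasurePreserving_fst.ae ae_abs_le_uniformMeasure,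
    Measure.quasiMeasurePreserving_snd.ae ae_abs_le_uniformMeasure] with p h1 h2
  exact (abs_add_le _ _).trans (by linarith)

/-- The density is at most `1/2`, being an average of translates of the uniform density. -/
lemma integral_exp_neg_mul_sq_triangleMeasure_le {a : ℝ} (ha : 0 < a) :
    ∫ v, Real.exp (-a * v ^ 2) ∂triangleMeasure ≤ √(Real.pi / a) / 2 := by
  have hbd : ∀ v : ℝ, ‖Real.exp (-a * v ^ 2)‖ ≤ 1 := by
    intro v
    rw [Real.norm_eq_abs, Real.abs_exp, Real.exp_le_one_iff]
    nlinarith [sq_nonneg v]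
  have h_int : Integrable (fun p : ℝ × ℝ => Real.exp (-a * (p.1 + p.2) ^ 2))
      (uniformMeasure.prod uniformMeasure) :=
    Integrable.of_bound (by fun_prop) 1 (ae_of_all _ fun p => hbd _)
  rw [triangleMeasure, Measure.conv, integral_map (by fun_prop) (by fun_prop),
    integral_prod _ h_int]
  have hinner : ∀ x : ℝ, ∫ y, Real.exp (-a * (x + y) ^ 2) ∂uniformMeasure ≤ √(Real.pi / a) / 2 := by
    intro x
    rw [uniformMeasure, integral_smul_measure]
    have h1 : ∫ y in Set.Ioc (-1 : ℝ) 1, Real.exp (-a * (x + y) ^ 2) ≤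
        ∫ y, Real.exp (-a * (x + y) ^ 2) :=
      setIntegral_le_integral ((integrable_exp_neg_mul_sq ha).comp_add_left x)
        (ae_of_all _ fun y => (Real.exp_pos _).le)
    rw [integral_add_left_eq_self (μ := volume) (fun y => Real.exp (-a * y ^ 2)) x, integral_gaussian] at h1
    simp only [ENNReal.toReal_inv, ENNReal.toReal_ofNat, smul_eq_mul]
    linarith
  calc _ ≤ ∫ _ : ℝ, √(Real.pi / a) / 2 ∂uniformMeasure :=
        integral_mono h_int.integral_prod_left (integrable_const _) hinner
    _ = _ := by simp

/-- A two-dimensional Esseen inequality. -/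
lemma measureReal_norm_le_le_integral {Ω : Type*} [MeasurableSpace Ω] (P : Measure Ω)
    [IsProbabilityMeasure P] {X : Ω → ℂ} (hX : AEMeasurable X P) {T : ℝ} (hT : 0 < T) :
    P.real {ω | ‖X ω‖ ≤ T} ≤ 4 * ∫ v, ‖∫ ω, Complex.exp
      ((((⟨v.1 / T, -v.2 / T⟩ : ℂ) * X ω).re : ℝ) * Complex.I) ∂P‖
        ∂(triangleMeasure.prod triangleMeasure) := by
  set K := triangleMeasure.prod triangleMeasure
  set s : Ω → ℝ := fun ω => Real.sinc ((X ω).re / T) ^ 2 * Real.sinc ((X ω).im / T) ^ 2 with hs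
  have hsmeas : AEStronglyMeasurable s P := by
    have : AEMeasurable s P := by
      have h1 : AEMeasurable (fun ω => (X ω).re / T) P :=
        (Complex.measurable_re.comp_aemeasurable hX).div_const T
      have h2 : AEMeasurable (fun ω => (X ω).im / T) P :=
        (Complex.measurable_im.comp_aemeasurable hX).div_const T
      exact (h1.sinc.pow_const 2).mul (h2.sinc.pow_const 2)
    exact this.aestronglyMeasurable
  have hsinc : ∀ x : ℝ, Real.sinc x ^ 2 ≤ 1 := fun x => by
    rw [← sq_abs]; exact pow_le_one₀ (abs_nonneg _) (Real.abs_sinc_le_one x)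
  have hs0 : ∀ ω, 0 ≤ s ω := fun ω => by simp only [hs]; positivity
  have hsint : Integrable s P := Integrable.of_bound hsmeas 1 (ae_of_all _ fun ω => by
    rw [Real.norm_eq_abs, abs_of_nonneg (hs0 ω)]
    exact mul_le_one₀ (hsinc _) (by positivity) (hsinc _))
  -- On the ball both squared sincs are at least `1/2`, so `s ≥ 1/4`; Markov's inequality gives the
  -- factor `4`.
  have h1 : P.real {ω | ‖X ω‖ ≤ T} ≤ 4 * ∫ ω, s ω ∂P := by
    have hm := mul_meas_ge_le_integral_of_nonneg (ae_of_all _ hs0) hsint (1 / 4)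
    have hsub : P.real {ω | ‖X ω‖ ≤ T} ≤ P.real {ω | 1 / 4 ≤ s ω} := by
      refine measureReal_mono fun ω hω => ?_
      have hω' : ‖X ω‖ ≤ T := hω
      have e1 : |(X ω).re / T| ≤ 1 := by
        rw [abs_div, abs_of_pos hT, div_le_one hT]; exact (Complex.abs_re_le_norm _).trans hω'
      have e2 : |(X ω).im / T| ≤ 1 := by
        rw [abs_div, abs_of_pos hT, div_le_one hT]; exact (Complex.abs_im_le_norm _).trans hω'
      show 1 / 4 ≤ s ω
      simp only [hs]
      nlinarith [half_le_sinc_sq e1, half_le_sinc_sq e2]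
    linarith
  have h2 : ∀ ω, ((s ω : ℝ) : ℂ) = ∫ v, Complex.exp
      ((((⟨v.1 / T, -v.2 / T⟩ : ℂ) * X ω).re : ℝ) * Complex.I) ∂K := by
    intro ω
    have e : ∀ v : ℝ × ℝ, Complex.exp ((((⟨v.1 / T, -v.2 / T⟩ : ℂ) * X ω).re : ℝ) * Complex.I)
        = Complex.exp (((X ω).re / T : ℝ) * v.1 * Complex.I)
          * Complex.exp (((X ω).im / T : ℝ) * v.2 * Complex.I) := by
      intro v
      rw [← Complex.exp_add, Complex.mul_re]
      congr 1
      push_cast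
      ring
    simp_rw [e]
    rw [integral_prod_mul (fun v : ℝ => Complex.exp (((X ω).re / T : ℝ) * v * Complex.I))
      (fun v : ℝ => Complex.exp (((X ω).im / T : ℝ) * v * Complex.I)), ← charFun_apply_real,
      ← charFun_apply_real, charFun_triangleMeasure, charFun_triangleMeasure]
    simp only [hs]
    push_cast
    ring
  have h3 : ((∫ ω, s ω ∂P : ℝ) : ℂ) = ∫ v, ∫ ω, Complex.exp
      ((((⟨v.1 / T, -v.2 / T⟩ : ℂ) * X ω).re : ℝ) * Complex.I) ∂P ∂K := by
    rw [← integral_complex_ofReal]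
    simp_rw [h2]
    refine integral_integral_swap ?_
    refine Integrable.of_bound ?_ 1 (ae_of_all _ fun p => ?_)
    · have hX1 : AEMeasurable (fun p : Ω × (ℝ × ℝ) => X p.1) (P.prod K) :=
        hX.comp_quasiMeasurePreserving Measure.quasiMeasurePreserving_fst
      have hre : AEMeasurable (fun p : Ω × (ℝ × ℝ) => (X p.1).re) (P.prod K) :=
        Complex.measurable_re.comp_aemeasurable hX1
      have him : AEMeasurable (fun p : Ω × (ℝ × ℝ) => (X p.1).im) (P.prod K) :=
        Complex.measurable_im.comp_aemeasurable hX1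
      refine AEMeasurable.aestronglyMeasurable ?_
      simp only [Function.uncurry_def, Complex.mul_re]
      fun_prop
    · simp only [Function.uncurry_def]
      rw [Complex.norm_exp_ofReal_mul_I]
  have h4 : ∫ ω, s ω ∂P ≤ ∫ v, ‖∫ ω, Complex.exp
      ((((⟨v.1 / T, -v.2 / T⟩ : ℂ) * X ω).re : ℝ) * Complex.I) ∂P‖ ∂K := by
    have e1 : ∫ ω, s ω ∂P = ‖((∫ ω, s ω ∂P : ℝ) : ℂ)‖ := by
      rw [Complex.norm_real, Real.norm_eq_abs, abs_of_nonneg (integral_nonneg hs0)]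
    rw [e1, h3]
    exact norm_integral_le_integral_norm _
  linarith

/-! ### Characteristic functions, symmetrisation and condition (H) -/

lemma norm_sq_charFun_eq (μ : Measure ℝ) [IsProbabilityMeasure μ] (s : ℝ) :
    ‖charFun μ s‖ ^ 2 = ∫ p : ℝ × ℝ, Real.cos (s * (p.1 - p.2)) ∂(μ.prod μ) := by
  have h : ((‖charFun μ s‖ ^ 2 : ℝ) : ℂ)
      = ∫ p : ℝ × ℝ, Complex.exp ((s * (p.1 - p.2) : ℝ) * Complex.I) ∂(μ.prod μ) := by
    rw [← Complex.normSq_eq_norm_sq, ← Complex.mul_conj, ← charFun_neg, charFun_apply_real,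
      charFun_apply_real, ← integral_prod_mul]
    refine integral_congr_ae (ae_of_all _ fun p => ?_)
    simp only
    rw [← Complex.exp_add]
    congr 1
    push_cast
    ring
  have h_int : Integrable (fun p : ℝ × ℝ => Complex.exp ((s * (p.1 - p.2) : ℝ) * Complex.I))
      (μ.prod μ) :=
    Integrable.of_bound (by fun_prop) 1 (ae_of_all _ fun p => by rw [Complex.norm_exp_ofReal_mul_I])
  have h2 := congrArg Complex.re h
  rw [Complex.ofReal_re] at h2
  rw [h2]
  have h3 := integral_re h_int
  simp only [RCLike.re_eq_complex_re, Complex.exp_ofReal_mul_I_re] at h3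
  exact h3.symm

/-- Apply `x ≤ exp(x - 1)` to `x = |φ|²`, the characteristic function of the symmetrised law, and
take the square root. -/
lemma norm_charFun_le_exp (μ : Measure ℝ) [IsProbabilityMeasure μ] (s : ℝ) :
    ‖charFun μ s‖ ≤
      Real.exp (-(1 / 2) * ∫ p : ℝ × ℝ, (1 - Real.cos (s * (p.1 - p.2))) ∂(μ.prod μ)) := by
  have h_int : Integrable (fun p : ℝ × ℝ => Real.cos (s * (p.1 - p.2))) (μ.prod μ) :=
    Integrable.of_bound (by fun_prop) 1 (ae_of_all _ fun p => Real.abs_cos_le_one _)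
  rw [integral_sub (integrable_const _) h_int, ← norm_sq_charFun_eq]
  simp only [integral_const, probReal_univ, smul_eq_mul, mul_one]
  refine le_of_sq_le_sq ?_ (Real.exp_pos _).le
  rw [← Real.exp_nat_mul]
  have := Real.add_one_le_exp ((2 : ℕ) * (-(1 / 2) * (1 - ‖charFun μ s‖ ^ 2)))
  push_cast at this ⊢
  linarith

lemma prod_norm_charFun_le (μ : Measure ℝ) [IsProbabilityMeasure μ] {n : ℕ} (s : ℕ → ℝ)
    {A : Set (ℝ × ℝ)} (hA : MeasurableSet A) {L : ℝ}
    (h : ∀ p ∈ A, L ≤ ∑ j ∈ Finset.range n, (1 - Real.cos (s j * (p.1 - p.2)))) :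
    ∏ j ∈ Finset.range n, ‖charFun μ (s j)‖ ≤ Real.exp (-(1 / 2) * (L * (μ.prod μ).real A)) := by
  have h_int : ∀ j, Integrable (fun p : ℝ × ℝ => 1 - Real.cos (s j * (p.1 - p.2))) (μ.prod μ) :=
    fun j => (integrable_const 1).sub
      (Integrable.of_bound (by fun_prop) 1 (ae_of_all _ fun p => Real.abs_cos_le_one _))
  calc ∏ j ∈ Finset.range n, ‖charFun μ (s j)‖
      ≤ ∏ j ∈ Finset.range n, Real.exp (-(1 / 2) *
          ∫ p : ℝ × ℝ, (1 - Real.cos (s j * (p.1 - p.2))) ∂(μ.prod μ)) :=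
        Finset.prod_le_prod (fun _ _ => norm_nonneg _) fun j _ => norm_charFun_le_exp μ (s j)
    _ = Real.exp (-(1 / 2) * ∫ p : ℝ × ℝ, ∑ j ∈ Finset.range n,
          (1 - Real.cos (s j * (p.1 - p.2))) ∂(μ.prod μ)) := by
        rw [← Real.exp_sum, ← Finset.mul_sum, integral_finsetSum _ fun j _ => h_int j]
    _ ≤ _ := by
        rw [Real.exp_le_exp]
        have h1 : L * (μ.prod μ).real A ≤ ∫ p : ℝ × ℝ, ∑ j ∈ Finset.range n,
            (1 - Real.cos (s j * (p.1 - p.2))) ∂(μ.prod μ) := by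
          calc L * (μ.prod μ).real A = ∫ p, A.indicator (fun _ => L) p ∂(μ.prod μ) := by
                rw [integral_indicator_const _ hA, smul_eq_mul, mul_comm]
            _ ≤ _ := by
                refine integral_mono ((integrable_const L).indicator hA)
                  (integrable_finsetSum _ fun j _ => h_int j) fun p => ?_
                by_cases hp : p ∈ A
                · simpa [hp] using h p hp
                · simp only [hp, not_false_eq_true, Set.indicator_of_notMem]
                  exact Finset.sum_nonneg fun j _ => sub_nonneg.2 (Real.cos_le_one _)
        linarith

lemma measurableSet_abs_sub_mem_Icc (M : ℝ) :
    MeasurableSet {x : ℝ × ℝ | 1 ≤ |x.1 - x.2| ∧ |x.1 - x.2| ≤ M} := by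
  have h : Measurable fun x : ℝ × ℝ => |x.1 - x.2| := by fun_prop
  exact h measurableSet_Icc

/-- Given `|x| ≤ M`, an independent copy avoids `[x - 1, x + 1]` with probability at least `q`, and
also stays in `[-M, M]` with probability at least `q - q/2`. -/
lemma ConditionH.exists_prod_real_pos {μ : Measure ℝ} [IsProbabilityMeasure μ] (h : ConditionH μ) :
    ∃ M p : ℝ, 0 < M ∧ 0 < p ∧
      p ≤ (μ.prod μ).real {x : ℝ × ℝ | 1 ≤ |x.1 - x.2| ∧ |x.1 - x.2| ≤ M} := by
  obtain ⟨M, q, hM, hq, hq1, hu, hMq⟩ := h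
  refine ⟨2 * M, q / 2 * (1 - q / 2), by positivity, by nlinarith, ?_⟩
  set A := {x : ℝ × ℝ | 1 ≤ |x.1 - x.2| ∧ |x.1 - x.2| ≤ 2 * M}
  have hA : MeasurableSet A := measurableSet_abs_sub_mem_Icc _
  have hBm : MeasurableSet {x : ℝ | M < |x|} := measurableSet_lt (by fun_prop) (by fun_prop)
  have hB : 1 - q / 2 ≤ μ.real {x : ℝ | M < |x|}ᶜ := by
    rw [probReal_compl_eq_one_sub hBm]; linarith
  have hslice : ∀ x : ℝ, x ∈ {x : ℝ | M < |x|}ᶜ → q / 2 ≤ μ.real (Prod.mk x ⁻¹' A) := by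
    intro x hx
    have hx' : |x| ≤ M := not_lt.1 hx
    have hcover : (Set.univ : Set ℝ) ⊆
        Prod.mk x ⁻¹' A ∪ ({y | |y - x| ≤ 1} ∪ {y | M < |y|}) := by
      intro y _
      by_cases h1 : |y - x| ≤ 1
      · exact Or.inr (Or.inl h1)
      by_cases h2 : M < |y|
      · exact Or.inr (Or.inr h2)
      refine Or.inl ⟨?_, ?_⟩
      · rw [abs_sub_comm]; exact (not_le.1 h1).le
      · exact (abs_sub _ _).trans (by linarith [not_lt.1 h2])
    have h1 := measureReal_mono (μ := μ) hcover
    have h2 := measureReal_union_le (μ := μ) (Prod.mk x ⁻¹' A) ({y | |y - x| ≤ 1} ∪ {y | M < |y|})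
    have h3 := measureReal_union_le (μ := μ) {y | |y - x| ≤ 1} {y | M < |y|}
    rw [probReal_univ] at h1
    linarith [hu x]
  have key : ENNReal.ofReal (q / 2) * μ {x : ℝ | M < |x|}ᶜ ≤ (μ.prod μ) A := by
    rw [Measure.prod_apply hA, ← lintegral_indicator_const hBm.compl]
    refine lintegral_mono fun x => ?_
    by_cases hx : x ∈ {x : ℝ | M < |x|}ᶜ
    · rw [Set.indicator_of_mem hx]
      exact ENNReal.ofReal_le_of_le_toReal (hslice x hx)
    · rw [Set.indicator_of_notMem hx]; exact zero_le
  have key2 := ENNReal.toReal_mono (measure_ne_top _ _) key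
  rw [ENNReal.toReal_mul, ENNReal.toReal_ofReal (by positivity)] at key2
  refine le_trans ?_ key2
  exact mul_le_mul_of_nonneg_left hB (by positivity)

/-! ### Small ball estimates for one Fourier coefficient -/

section SmallBall

variable {Ω : Type*} [MeasurableSpace Ω] {P : Measure Ω} {μ : Measure ℝ} {ξ : ℕ → Ω → ℝ}

lemma IsIID.integral_exp_sum_mul_I (h : IsIID P μ ξ) (n : ℕ) (c : ℕ → ℝ) :
    ∫ ω, Complex.exp ((∑ j ∈ Finset.range n, c j * ξ j ω : ℝ) * Complex.I) ∂P
      = ∏ j ∈ Finset.range n, charFun μ (c j) := by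
  have hind : iIndepFun (fun (j : Fin n) => ξ j) P := h.2.precomp Fin.val_injective
  have h1 : ∀ ω, Complex.exp ((∑ j ∈ Finset.range n, c j * ξ j ω : ℝ) * Complex.I)
      = ∏ j : Fin n, (fun x : ℝ => Complex.exp (c j * x * Complex.I)) (ξ j ω) := by
    intro ω
    rw [← Complex.exp_sum, Finset.sum_range]
    push_cast
    rw [Finset.sum_mul]
  simp_rw [h1]
  rw [hind.integral_fun_prod_comp (f := fun (j : Fin n) (x : ℝ) => Complex.exp (c j * x * Complex.I))
    (fun j => (h.1 j).aemeasurable) (fun j => by fun_prop), Finset.prod_range]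
  refine Finset.prod_congr rfl fun j _ => ?_
  rw [charFun_apply_real]
  exact (h.1 j).integral_comp (f := fun x : ℝ => Complex.exp (c j * x * Complex.I)) (by fun_prop)

lemma re_mul_dftCoeff (n k : ℕ) (x : ℕ → ℝ) (u : ℂ) :
    (u * dftCoeff n x k).re = ∑ j ∈ Finset.range n, (u * rootExp n k ^ j).re * x j := by
  rw [dftCoeff, Finset.mul_sum, Complex.re_sum]
  refine Finset.sum_congr rfl fun j _ => ?_
  rw [← Complex.re_mul_ofReal]
  congr 1
  ring

lemma IsIID.aemeasurable_dftCoeff (h : IsIID P μ ξ) (n k : ℕ) :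
    AEMeasurable (fun ω => dftCoeff n (fun j => ξ j ω) k) P := by
  unfold dftCoeff
  refine Finset.aemeasurable_fun_sum _ fun j _ => ?_
  exact (Complex.measurable_ofReal.comp_aemeasurable (h.1 j).aemeasurable).mul_const _

lemma norm_sq_complexMk_div (v : ℝ × ℝ) (T : ℝ) :
    ‖(⟨v.1 / T, -v.2 / T⟩ : ℂ)‖ ^ 2 = (v.1 ^ 2 + v.2 ^ 2) / T ^ 2 := by
  rw [← Complex.normSq_eq_norm_sq, Complex.normSq_apply]
  ring

lemma norm_complexMk_div_le {v : ℝ × ℝ} (h1 : |v.1| ≤ 2) (h2 : |v.2| ≤ 2) {T : ℝ} (hT : 0 < T) :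
    ‖(⟨v.1 / T, -v.2 / T⟩ : ℂ)‖ ≤ 3 / T := by
  refine le_of_sq_le_sq ?_ (by positivity)
  rw [norm_sq_complexMk_div, div_pow]
  gcongr
  nlinarith [sq_abs v.1, sq_abs v.2, abs_nonneg v.1, abs_nonneg v.2]

lemma ae_abs_le_triangleMeasure_prod :
    ∀ᵐ v : ℝ × ℝ ∂(triangleMeasure.prod triangleMeasure), |v.1| ≤ 2 ∧ |v.2| ≤ 2 := by
  filter_upwards [Measure.quasiMeasurePreserving_fst.ae ae_abs_le_triangleMeasure,
    Measure.quasiMeasurePreserving_snd.ae ae_abs_le_triangleMeasure] with p h1 h2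
  exact ⟨h1, h2⟩

variable [IsProbabilityMeasure P] [IsProbabilityMeasure μ]

/-- Small ball estimate from a lower bound for the sums `∑ (1 - cos (Re (u z ^ j) (x - y)))`. -/
lemma IsIID.measureReal_norm_dftCoeff_le (h : IsIID P μ ξ) {n k : ℕ} {T : ℝ} (hT : 0 < T) {M p : ℝ}
    (hp : p ≤ (μ.prod μ).real {x : ℝ × ℝ | 1 ≤ |x.1 - x.2| ∧ |x.1 - x.2| ≤ M}) {L : ℝ × ℝ → ℝ}
    (hLm : Measurable L) (hL0 : ∀ v, 0 ≤ L v)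
    (hL : ∀ v : ℝ × ℝ, ‖(⟨v.1 / T, -v.2 / T⟩ : ℂ)‖ ≤ 3 / T → ∀ y : ℝ, 1 ≤ |y| → |y| ≤ M →
      L v ≤ ∑ j ∈ Finset.range n,
        (1 - Real.cos ((y * ⟨v.1 / T, -v.2 / T⟩ : ℂ) * rootExp n k ^ j).re)) (hp0 : 0 ≤ p) :
    P.real {ω | ‖dftCoeff n (fun j => ξ j ω) k‖ ≤ T} ≤
      4 * ∫ v, Real.exp (-(p / 2) * L v) ∂(triangleMeasure.prod triangleMeasure) := by
  refine (measureReal_norm_le_le_integral P (h.aemeasurable_dftCoeff n k) hT).trans ?_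
  refine mul_le_mul_of_nonneg_left ?_ (by norm_num)
  refine integral_mono_of_nonneg (ae_of_all _ fun v => norm_nonneg _) ?_ ?_
  · refine Integrable.of_bound (by fun_prop) 1 (ae_of_all _ fun v => ?_)
    rw [Real.norm_eq_abs, Real.abs_exp, Real.exp_le_one_iff]
    have := mul_nonneg (div_nonneg hp0 (zero_le_two (α := ℝ))) (hL0 v)
    linarith
  filter_upwards [ae_abs_le_triangleMeasure_prod] with v hv
  simp_rw [re_mul_dftCoeff]
  rw [h.integral_exp_sum_mul_I, norm_prod]
  refine (prod_norm_charFun_le μ (L := L v) _ (measurableSet_abs_sub_mem_Icc M) ?_).trans ?_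
  · rintro x ⟨hx1, hx2⟩
    refine (hL v (norm_complexMk_div_le hv.1 hv.2 hT) _ hx1 hx2).trans (le_of_eq ?_)
    refine Finset.sum_congr rfl fun j _ => ?_
    rw [mul_assoc, Complex.re_ofReal_mul, mul_comm (x.1 - x.2)]
  · rw [Real.exp_le_exp]
    have := mul_le_mul_of_nonneg_left hp (hL0 v)
    linarith

lemma integral_exp_neg_mul_norm_sq_le {a : ℝ} (ha : 0 < a) :
    ∫ v : ℝ × ℝ, Real.exp (-a * (v.1 ^ 2 + v.2 ^ 2)) ∂(triangleMeasure.prod triangleMeasure)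
      ≤ Real.pi / a / 4 := by
  have e : ∀ v : ℝ × ℝ, Real.exp (-a * (v.1 ^ 2 + v.2 ^ 2))
      = Real.exp (-a * v.1 ^ 2) * Real.exp (-a * v.2 ^ 2) := by
    intro v; rw [← Real.exp_add]; ring_nf
  simp_rw [e]
  rw [integral_prod_mul (fun x : ℝ => Real.exp (-a * x ^ 2)) (fun x : ℝ => Real.exp (-a * x ^ 2))]
  have h1 := integral_exp_neg_mul_sq_triangleMeasure_le ha
  have h0 : 0 ≤ ∫ v, Real.exp (-a * v ^ 2) ∂triangleMeasure :=
    integral_nonneg fun v => (Real.exp_pos _).le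
  have h2 := mul_le_mul h1 h1 h0 (by positivity)
  have h3 : √(Real.pi / a) * √(Real.pi / a) = Real.pi / a := Real.mul_self_sqrt (by positivity)
  linarith

/-- The frequencies have norm at most `3/T` and the differences at most `M`, so `6πM ≤ T d` is
exactly what the cosine-sum bound requires. Splitting `exp(-c min(x, 1)) ≤ exp(-c x) + exp(-c)`
leaves a planar Gaussian integral of order `T²/n` and an exponentially small term. -/
lemma IsIID.measureReal_norm_dftCoeff_le_of_three_le_orderOf (h : IsIID P μ ξ) {M p : ℝ}
    (hp0 : 0 < p) (hM : 0 < M)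
    (hp : p ≤ (μ.prod μ).real {x : ℝ × ℝ | 1 ≤ |x.1 - x.2| ∧ |x.1 - x.2| ≤ M}) {n k : ℕ}
    (hn : n ≠ 0) (hd : 3 ≤ orderOf (rootExp n k)) {T : ℝ} (hT : 0 < T)
    (hTd : 6 * Real.pi * M ≤ T * orderOf (rootExp n k)) :
    P.real {ω | ‖dftCoeff n (fun j => ξ j ω) k‖ ≤ T} ≤
      8 * Real.pi ^ 3 * T ^ 2 / (p * n) + 4 * Real.exp (-(p / (8 * Real.pi ^ 2)) * n) := by
  have hn' : (0 : ℝ) < n := by exact_mod_cast Nat.pos_of_ne_zero hn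
  have hπ := Real.pi_pos
  set d := orderOf (rootExp n k)
  set L : ℝ × ℝ → ℝ := fun v => n / (4 * Real.pi ^ 2) * min ((v.1 ^ 2 + v.2 ^ 2) / T ^ 2) 1 with hL
  have hLm : Measurable L := by fun_prop
  have hL0 : ∀ v, 0 ≤ L v := fun v => by simp only [hL]; positivity
  refine (h.measureReal_norm_dftCoeff_le (k := k) hT hp hLm hL0 ?_ hp0.le).trans ?_
  · intro v hv y hy1 hyM
    set u : ℂ := ⟨v.1 / T, -v.2 / T⟩ with hu
    have e : ‖u‖ ^ 2 = (v.1 ^ 2 + v.2 ^ 2) / T ^ 2 := norm_sq_complexMk_div v T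
    have hyu : ‖(y : ℂ) * u‖ = |y| * ‖u‖ := by rw [norm_mul, Complex.norm_real, Real.norm_eq_abs]
    refine le_trans ?_ (min_sq_le_sum_one_sub_cos (rootExp_pow_self hn k) (norm_rootExp n k) hd ?_)
    · simp only [hL]
      rw [← e, hyu]
      gcongr
      exact le_mul_of_one_le_left (norm_nonneg _) hy1
    · rw [hyu]
      calc 2 * Real.pi * (|y| * ‖u‖) ≤ 2 * Real.pi * (M * (3 / T)) := by gcongr
        _ = 6 * Real.pi * M / T := by ring
        _ ≤ d := by rw [div_le_iff₀ hT]; linarith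
  · set c := p / (8 * Real.pi ^ 2) * n with hc
    have hc0 : 0 < c := by positivity
    have hbound : ∀ v : ℝ × ℝ, Real.exp (-(p / 2) * L v) ≤
        Real.exp (-(c / T ^ 2) * (v.1 ^ 2 + v.2 ^ 2)) + Real.exp (-c) := by
      intro v
      have e1 : -(p / 2) * L v = -c * min ((v.1 ^ 2 + v.2 ^ 2) / T ^ 2) 1 := by
        simp only [hL, hc]; ring
      rw [e1]
      rcases min_choice ((v.1 ^ 2 + v.2 ^ 2) / T ^ 2) 1 with h | h
      · rw [h]
        have : -c * ((v.1 ^ 2 + v.2 ^ 2) / T ^ 2) = -(c / T ^ 2) * (v.1 ^ 2 + v.2 ^ 2) := by ring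
        rw [this]
        linarith [Real.exp_pos (-c)]
      · rw [h, mul_one]
        linarith [Real.exp_pos (-(c / T ^ 2) * (v.1 ^ 2 + v.2 ^ 2))]
    have hint1 : Integrable (fun v : ℝ × ℝ => Real.exp (-(c / T ^ 2) * (v.1 ^ 2 + v.2 ^ 2)))
        (triangleMeasure.prod triangleMeasure) := by
      refine Integrable.of_bound (by fun_prop) 1 (ae_of_all _ fun v => ?_)
      rw [Real.norm_eq_abs, Real.abs_exp, Real.exp_le_one_iff]
      have : 0 ≤ c / T ^ 2 * (v.1 ^ 2 + v.2 ^ 2) := by positivity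
      linarith
    have h1 : ∫ v, Real.exp (-(p / 2) * L v) ∂(triangleMeasure.prod triangleMeasure)
        ≤ Real.pi / (c / T ^ 2) / 4 + Real.exp (-c) := by
      calc _ ≤ ∫ v : ℝ × ℝ, (Real.exp (-(c / T ^ 2) * (v.1 ^ 2 + v.2 ^ 2)) + Real.exp (-c))
              ∂(triangleMeasure.prod triangleMeasure) :=
            integral_mono_of_nonneg (ae_of_all _ fun v => (Real.exp_pos _).le)
              (hint1.add (integrable_const _)) (ae_of_all _ hbound)
        _ ≤ _ := by
            rw [integral_add hint1 (integrable_const _)]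
            have := integral_exp_neg_mul_norm_sq_le (a := c / T ^ 2) (by positivity)
            simp only [integral_const, probReal_univ, one_smul]
            linarith
    have e2 : 4 * (Real.pi / (c / T ^ 2) / 4) = 8 * Real.pi ^ 3 * T ^ 2 / (p * n) := by
      simp only [hc]; field_simp
    have e3 : -(p / (8 * Real.pi ^ 2)) * n = -c := by simp only [hc]; ring
    rw [e3, ← e2]
    linarith

/-- Here `z = ±1` and the coefficient is real: only `v.1` contributes, and a one-dimensional
Gaussian integral gives order `T/√n`. The condition `M ≤ T` keeps `|w| ≤ 3 < π`, inside the range of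
the quadratic cosine bound. -/
lemma IsIID.measureReal_norm_dftCoeff_le_of_sq_eq_one (h : IsIID P μ ξ) {M p : ℝ}
    (hp0 : 0 < p)
    (hp : p ≤ (μ.prod μ).real {x : ℝ × ℝ | 1 ≤ |x.1 - x.2| ∧ |x.1 - x.2| ≤ M}) {n k : ℕ}
    (hn : n ≠ 0) (hd : rootExp n k ^ 2 = 1) {T : ℝ} (hT : 0 < T) (hTM : M ≤ T) :
    P.real {ω | ‖dftCoeff n (fun j => ξ j ω) k‖ ≤ T} ≤
      2 * √(Real.pi ^ 3 * T ^ 2 / (p * n)) := by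
  have hn' : (0 : ℝ) < n := by exact_mod_cast Nat.pos_of_ne_zero hn
  have hπ := Real.pi_gt_three
  set L : ℝ × ℝ → ℝ := fun v => 2 * n / (Real.pi ^ 2 * T ^ 2) * v.1 ^ 2 with hL
  have hLm : Measurable L := by fun_prop
  have hL0 : ∀ v, 0 ≤ L v := fun v => by simp only [hL]; positivity
  refine (h.measureReal_norm_dftCoeff_le (k := k) hT hp hLm hL0 ?_ hp0.le).trans ?_
  · intro v hv y hy1 hyM
    set u : ℂ := ⟨v.1 / T, -v.2 / T⟩ with hu
    have hyu : ‖(y : ℂ) * u‖ = |y| * ‖u‖ := by rw [norm_mul, Complex.norm_real, Real.norm_eq_abs]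
    have h1 : ‖(y : ℂ) * u‖ ≤ Real.pi := by
      rw [hyu]
      calc |y| * ‖u‖ ≤ T * (3 / T) := by gcongr; linarith
        _ = 3 := by field_simp
        _ ≤ Real.pi := hπ.le
    refine le_trans ?_ (sum_re_sq_le_sum_one_sub_cos n (norm_rootExp n k) h1)
    have h2 : ∀ j ∈ Finset.range n, ((y : ℂ) * u * rootExp n k ^ j).re ^ 2 = y ^ 2 * (v.1 / T) ^ 2 := by
      intro j _
      have h3 : rootExp n k = 1 ∨ rootExp n k = -1 := mul_self_eq_one_iff.1 (by rw [← sq]; exact hd)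
      have h4 : rootExp n k ^ j = 1 ∨ rootExp n k ^ j = -1 := by
        rcases h3 with h | h <;> rw [h]
        · left; simp
        · exact neg_one_pow_eq_or ℂ j
      rcases h4 with h | h <;> rw [h] <;> simp [hu] <;> ring
    rw [Finset.sum_congr rfl h2, Finset.sum_const, Finset.card_range, nsmul_eq_mul]
    have hy2 : 1 ≤ y ^ 2 := by rw [← sq_abs]; exact one_le_pow₀ hy1
    calc L v = 2 / Real.pi ^ 2 * (n * (1 * (v.1 / T) ^ 2)) := by simp only [hL]; field_simp
      _ ≤ _ := by gcongr
  · set a := p * n / (Real.pi ^ 2 * T ^ 2) with ha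
    have ha0 : 0 < a := by positivity
    have e1 : ∀ v : ℝ × ℝ, Real.exp (-(p / 2) * L v) = Real.exp (-a * v.1 ^ 2) := by
      intro v; congr 1; simp only [hL, ha]; field_simp
    simp_rw [e1]
    have e2 := integral_prod_mul (μ := triangleMeasure) (ν := triangleMeasure)
      (fun x : ℝ => Real.exp (-a * x ^ 2)) (fun _ : ℝ => (1 : ℝ))
    simp only [mul_one, integral_const, probReal_univ, one_smul] at e2
    rw [e2]
    have h1 := integral_exp_neg_mul_sq_triangleMeasure_le ha0
    have e3 : Real.pi / a = Real.pi ^ 3 * T ^ 2 / (p * n) := by simp only [ha]; field_simp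
    rw [e3] at h1
    linarith

end SmallBall

/-! ### Union bound over the roots of unity, grouped by order -/

lemma card_filter_rootExp_pow_eq_one_le {n : ℕ} (hn : n ≠ 0) {d : ℕ} (hd : 0 < d) :
    (Finset.filter (fun k => rootExp n k ^ d = 1) (Finset.range n)).card ≤ d := by
  have h1 : (Finset.filter (fun k => rootExp n k ^ d = 1) (Finset.range n)).card
      ≤ (Polynomial.nthRootsFinset d (1 : ℂ)).card := by
    refine Finset.card_le_card_of_injOn (fun k => rootExp n k) ?_ ?_
    · intro k hk
      simp only [Finset.coe_filter, Set.mem_ofPred_eq] at hk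
      exact (Polynomial.mem_nthRootsFinset hd 1).2 hk.2
    · intro k hk l hl hkl
      simp only [Finset.coe_filter, Finset.mem_range, Set.mem_ofPred_eq] at hk hl
      simp only at hkl
      rw [rootExp_eq_pow n k, rootExp_eq_pow n l] at hkl
      exact (isPrimitiveRoot_rootExp_one hn).pow_inj hk.1 hl.1 hkl
  refine h1.trans ?_
  classical
  rw [Polynomial.nthRootsFinset_def]
  exact (Multiset.toFinset_card_le _).trans (Polynomial.card_nthRoots d 1)

lemma orderOf_rootExp_mem_Icc {n : ℕ} (hn : n ≠ 0) (k : ℕ) :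
    orderOf (rootExp n k) ∈ Finset.Icc 1 n := by
  have h := orderOf_dvd_of_pow_eq_one (rootExp_pow_self hn k)
  exact Finset.mem_Icc.2 ⟨Nat.pos_of_dvd_of_pos h (Nat.pos_of_ne_zero hn),
    Nat.le_of_dvd (Nat.pos_of_ne_zero hn) h⟩

/-- Order `d` occurs at most `d` times, so the sum is dominated by the harmonic sum. -/
lemma sum_inv_orderOf_rootExp_sq_le {n : ℕ} (hn : n ≠ 0) :
    ∑ k ∈ Finset.range n, 1 / (orderOf (rootExp n k) : ℝ) ^ 2 ≤ 1 + Real.log n := by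
  rw [← Finset.sum_fiberwise_of_maps_to (t := Finset.Icc 1 n)
    (g := fun k => orderOf (rootExp n k)) fun k _ => orderOf_rootExp_mem_Icc hn k]
  have h1 : ∀ d ∈ Finset.Icc 1 n,
      ∑ k ∈ Finset.range n with orderOf (rootExp n k) = d, 1 / (orderOf (rootExp n k) : ℝ) ^ 2
        ≤ (d : ℝ)⁻¹ := by
    intro d hd
    have hd1 : 0 < d := (Finset.mem_Icc.1 hd).1
    have hd' : (0 : ℝ) < d := by exact_mod_cast hd1
    have hcard : ((Finset.filter (fun k => orderOf (rootExp n k) = d) (Finset.range n)).card : ℝ)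
        ≤ d := by
      have h2 : Finset.filter (fun k => orderOf (rootExp n k) = d) (Finset.range n) ⊆
          Finset.filter (fun k => rootExp n k ^ d = 1) (Finset.range n) := by
        refine Finset.monotone_filter_right _ fun k _ hk => ?_
        rw [← hk]; exact pow_orderOf_eq_one _
      exact_mod_cast (Finset.card_le_card h2).trans (card_filter_rootExp_pow_eq_one_le hn hd1)
    calc _ = ∑ k ∈ Finset.range n with orderOf (rootExp n k) = d, 1 / (d : ℝ) ^ 2 :=
          Finset.sum_congr rfl fun k hk => by rw [(Finset.mem_filter.1 hk).2]
      _ ≤ d * (1 / (d : ℝ) ^ 2) := by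
          rw [Finset.sum_const, nsmul_eq_mul]; gcongr
      _ = (d : ℝ)⁻¹ := by field_simp
  refine (Finset.sum_le_sum h1).trans ?_
  have h2 := harmonic_le_one_add_log n
  rw [harmonic_eq_sum_Icc] at h2
  push_cast at h2
  exact h2

/-- A crude bound suffices: divided by `n` it is `O(n^(-1/2))`, the size already forced by the real
roots. -/
lemma one_add_log_le_two_mul_sqrt {n : ℕ} (hn : n ≠ 0) : 1 + Real.log n ≤ 2 * √n := by
  have hn' : (0 : ℝ) < n := by exact_mod_cast Nat.pos_of_ne_zero hn
  have h := Real.log_le_sub_one_of_pos (Real.sqrt_pos.2 hn')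
  rw [Real.log_sqrt hn'.le] at h
  linarith

lemma mul_exp_neg_mul_le {c : ℝ} (hc : 0 < c) {n : ℕ} (hn : n ≠ 0) :
    n * Real.exp (-c * n) ≤ 2 / c ^ 2 * (1 / √n) := by
  have hn' : (1 : ℝ) ≤ n := by exact_mod_cast Nat.pos_of_ne_zero hn
  have h1 := Real.quadratic_le_exp_of_nonneg (x := c * n) (by positivity)
  have h2 : (c * n) ^ 2 / 2 ≤ Real.exp (c * n) := by
    have : 0 ≤ c * n := by positivity
    linarith
  have h3 : √n ≤ n := by
    rw [Real.sqrt_le_left (by positivity)]; nlinarith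
  have e : -c * n = -(c * n) := by ring
  rw [e, Real.exp_neg]
  calc n * (Real.exp (c * n))⁻¹ ≤ n * ((c * n) ^ 2 / 2)⁻¹ := by gcongr
    _ = 2 / c ^ 2 * (1 / n) := by field_simp
    _ ≤ _ := by
        gcongr

section

variable {μ : Measure ℝ} [IsProbabilityMeasure μ]

lemma exists_measureReal_norm_dftCoeff_lt_le (hH : ConditionH μ) :
    ∃ a b c D : ℝ, 0 < a ∧ 0 < b ∧ 0 < c ∧ 0 < D ∧
      ∀ (Ω : Type*) [MeasurableSpace Ω] (P : Measure Ω) [IsProbabilityMeasure P] (ξ : ℕ → Ω → ℝ),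
        IsIID P μ ξ → ∀ n : ℕ, n ≠ 0 → ∀ k : ℕ, ∀ t : ℝ, 0 < t → t ≤ 1 →
          P.real {ω | ‖dftCoeff n (fun j => ξ j ω) k‖ < t} ≤
            a * (t ^ 2 / n) + b / n * (1 / (orderOf (rootExp n k) : ℝ) ^ 2)
              + 4 * Real.exp (-c * n) + (if rootExp n k ^ 2 = 1 then D / √n else 0) := by
  obtain ⟨M, p, hM, hp0, hp⟩ := hH.exists_prod_real_pos
  have hπ := Real.pi_pos
  refine ⟨16 * Real.pi ^ 3 / p, 16 * Real.pi ^ 3 / p * (6 * Real.pi * M) ^ 2,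
    p / (8 * Real.pi ^ 2), 2 * √(Real.pi ^ 3 * (M + 1) ^ 2 / p), by positivity, by positivity,
    by positivity, by positivity, ?_⟩
  intro Ω _ P _ ξ h n hn k t ht ht1
  have hn' : (0 : ℝ) < n := by exact_mod_cast Nat.pos_of_ne_zero hn
  have hmono : ∀ T, t ≤ T → P.real {ω | ‖dftCoeff n (fun j => ξ j ω) k‖ < t} ≤
      P.real {ω | ‖dftCoeff n (fun j => ξ j ω) k‖ ≤ T} := fun T hT =>
    measureReal_mono fun ω hω => (le_of_lt hω).trans hT
  have hd1 := (Finset.mem_Icc.1 (orderOf_rootExp_mem_Icc hn k)).1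
  split_ifs with h2
  · refine (hmono (M + 1) (by linarith)).trans ?_
    refine (h.measureReal_norm_dftCoeff_le_of_sq_eq_one hp0 hp hn h2 (by positivity)
      (by linarith)).trans ?_
    have e : 2 * √(Real.pi ^ 3 * (M + 1) ^ 2 / (p * n))
        = 2 * √(Real.pi ^ 3 * (M + 1) ^ 2 / p) / √n := by
      rw [← div_div, Real.sqrt_div (by positivity) (n : ℝ)]; ring
    rw [e]
    refine le_add_of_nonneg_left ?_
    positivity
  · have hd3 : 3 ≤ orderOf (rootExp n k) := by
      by_contra hlt
      have h3 : orderOf (rootExp n k) = 1 ∨ orderOf (rootExp n k) = 2 := by omega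
      refine h2 (orderOf_dvd_iff_pow_eq_one.1 ?_)
      rcases h3 with h3 | h3 <;> simp [h3]
    set d := orderOf (rootExp n k)
    have hd' : (0 : ℝ) < d := by exact_mod_cast hd1
    -- The radius is enlarged just enough to meet the order condition.
    set T := t + 6 * Real.pi * M / d with hT
    refine (hmono T (le_add_of_nonneg_right (by positivity))).trans ?_
    have hTd : 6 * Real.pi * M ≤ T * d := by
      rw [hT, add_mul, div_mul_cancel₀ _ hd'.ne']
      exact le_add_of_nonneg_left (by positivity)
    refine (h.measureReal_norm_dftCoeff_le_of_three_le_orderOf hp0 hM hp hn hd3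
      (by positivity) hTd).trans ?_
    have hT2 : T ^ 2 ≤ 2 * t ^ 2 + 2 * (6 * Real.pi * M / d) ^ 2 := by
      rw [hT]; nlinarith [sq_nonneg (t - 6 * Real.pi * M / d)]
    have e : 8 * Real.pi ^ 3 * T ^ 2 / (p * n) ≤ 16 * Real.pi ^ 3 / p * (t ^ 2 / n)
        + 16 * Real.pi ^ 3 / p * (6 * Real.pi * M) ^ 2 / n * (1 / (d : ℝ) ^ 2) := by
      calc 8 * Real.pi ^ 3 * T ^ 2 / (p * n)
          ≤ 8 * Real.pi ^ 3 * (2 * t ^ 2 + 2 * (6 * Real.pi * M / d) ^ 2) / (p * n) := by gcongr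
        _ = _ := by field_simp; ring
    linarith

/-- With high probability all the Fourier coefficients of an i.i.d. sequence are at least `t`. -/
lemma exists_measureReal_exists_norm_dftCoeff_lt_le (hH : ConditionH μ) :
    ∃ C : ℝ, 0 < C ∧
      ∀ (Ω : Type*) [MeasurableSpace Ω] (P : Measure Ω) [IsProbabilityMeasure P] (ξ : ℕ → Ω → ℝ),
        IsIID P μ ξ → ∀ n : ℕ, n ≠ 0 → ∀ t : ℝ, 0 < t →
          P.real {ω | ∃ k ∈ Finset.range n, ‖dftCoeff n (fun j => ξ j ω) k‖ < t} ≤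
            C * (t ^ 2 + 1 / √n) := by
  obtain ⟨a, b, c, D, ha, hb, hc, hD, hall⟩ := exists_measureReal_norm_dftCoeff_lt_le hH
  refine ⟨1 + a + 2 * b + 8 / c ^ 2 + 2 * D, by positivity, ?_⟩
  intro Ω _ P _ ξ h n hn t ht
  have hn' : (0 : ℝ) < n := by exact_mod_cast Nat.pos_of_ne_zero hn
  have hs : 0 < √(n : ℝ) := Real.sqrt_pos.2 hn'
  rcases le_or_gt t 1 with ht1 | ht1
  swap
  -- For `t > 1` the bound is trivial; the summand `1` in the constant serves this case.
  · refine measureReal_le_one.trans ?_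
    have h1 : 1 ≤ t ^ 2 + 1 / √n := by
      have : 0 < 1 / √(n : ℝ) := by positivity
      nlinarith
    have h2 : 1 ≤ 1 + a + 2 * b + 8 / c ^ 2 + 2 * D := by
      have : 0 < 8 / c ^ 2 := by positivity
      linarith
    nlinarith
  have hunion : {ω | ∃ k ∈ Finset.range n, ‖dftCoeff n (fun j => ξ j ω) k‖ < t}
      = ⋃ k ∈ Finset.range n, {ω | ‖dftCoeff n (fun j => ξ j ω) k‖ < t} := by
    ext ω; simp
  rw [hunion]
  refine (measureReal_biUnion_finset_le _ _).trans ?_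
  refine (Finset.sum_le_sum fun k _ => hall Ω P ξ h n hn k t ht ht1).trans ?_
  rw [Finset.sum_add_distrib, Finset.sum_add_distrib, Finset.sum_add_distrib, ← Finset.mul_sum, ← Finset.mul_sum,
    Finset.sum_const, Finset.sum_const, Finset.card_range, nsmul_eq_mul, nsmul_eq_mul,
    ← Finset.sum_filter, Finset.sum_const, nsmul_eq_mul]
  have e1 : a * (n * (t ^ 2 / n)) = a * t ^ 2 := by field_simp
  have e2 : b / n * ∑ k ∈ Finset.range n, 1 / (orderOf (rootExp n k) : ℝ) ^ 2
      ≤ 2 * b * (1 / √n) := by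
    calc _ ≤ b / n * (2 * √n) := by
          gcongr
          exact (sum_inv_orderOf_rootExp_sq_le hn).trans (one_add_log_le_two_mul_sqrt hn)
      _ = 2 * b * (√n / n) := by ring
      _ = 2 * b * (1 / √n) := by rw [Real.sqrt_div_self']
  have e3 : n * (4 * Real.exp (-c * n)) ≤ 8 / c ^ 2 * (1 / √n) := by
    have := mul_exp_neg_mul_le hc hn
    have e : 8 / c ^ 2 * (1 / √(n : ℝ)) = 4 * (2 / c ^ 2 * (1 / √n)) := by ring
    rw [e]; linarith
  have e4 : ((Finset.filter (fun k => rootExp n k ^ 2 = 1) (Finset.range n)).card : ℝ) * (D / √n)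
      ≤ 2 * D * (1 / √n) := by
    have h1 : ((Finset.filter (fun k => rootExp n k ^ 2 = 1) (Finset.range n)).card : ℝ) ≤ 2 := by
      exact_mod_cast card_filter_rootExp_pow_eq_one_le hn two_pos
    calc _ ≤ 2 * (D / √n) := by gcongr
      _ = _ := by ring
  have hx : 0 < 1 / √(n : ℝ) := by positivity
  have hq : 0 < 8 / c ^ 2 := by positivity
  set r := 1 / √(n : ℝ)
  have hfin : a * t ^ 2 + 2 * b * r + 8 / c ^ 2 * r + 2 * D * r ≤
      (1 + a + 2 * b + 8 / c ^ 2 + 2 * D) * (t ^ 2 + r) := by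
    have ht2 : 0 ≤ t ^ 2 := by positivity
    have : 0 ≤ (1 + 2 * b + 8 / c ^ 2 + 2 * D) * t ^ 2 + (1 + a) * r := by positivity
    linarith
  linarith

end

/-! ### Chernoff bounds for the Fourier coefficients -/

lemma exp_le_one_add_add_sq_mul_exp_abs (y : ℝ) :
    Real.exp y ≤ 1 + y + y ^ 2 * Real.exp |y| := by
  rcases le_or_gt |y| 1 with h | h
  · have h1 := (abs_le.1 (Real.abs_exp_sub_one_sub_id_le h)).2
    have h2 : y ^ 2 ≤ y ^ 2 * Real.exp |y| :=
      le_mul_of_one_le_right (sq_nonneg y) (Real.one_le_exp (abs_nonneg y))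
    linarith
  · have hy2 : 1 ≤ y ^ 2 := by rw [← sq_abs]; exact one_le_pow₀ h.le
    rcases le_total 0 y with h0 | h0
    · rw [abs_of_nonneg h0] at *
      have := mul_le_mul_of_nonneg_right hy2 (Real.exp_pos y).le
      linarith
    · have h1 : Real.exp y ≤ 1 := Real.exp_le_one_iff.2 h0
      have h2 := Real.add_one_le_exp |y|
      have h3 := mul_le_mul_of_nonneg_right hy2 (Real.exp_pos |y|).le
      rw [abs_of_nonpos h0] at *
      linarith

section

variable {μ : Measure ℝ} [IsProbabilityMeasure μ]

/-- A general `f` with nearly zero mean is allowed so that the bound also covers truncated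
variables, whose mean is only small. The factor `c` stands for the weights `Re (u z^j)`. -/
lemma integrable_exp_mul_and_integral_le {f : ℝ → ℝ} (hf : Integrable f μ) {s m B : ℝ} (hs : 0 ≤ s)
    (hm : |∫ x, f x ∂μ| ≤ m) (h_int : Integrable (fun x => f x ^ 2 * Real.exp (s * |f x|)) μ)
    (hB : ∫ x, f x ^ 2 * Real.exp (s * |f x|) ∂μ ≤ B) {c : ℝ} (hc : |c| ≤ 1) :
    Integrable (fun x => Real.exp (s * c * f x)) μ ∧
      ∫ x, Real.exp (s * c * f x) ∂μ ≤ Real.exp (s * m + s ^ 2 * B) := by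
  have hpt : ∀ x, Real.exp (s * c * f x) ≤
      1 + s * c * f x + s ^ 2 * (f x ^ 2 * Real.exp (s * |f x|)) := by
    intro x
    refine (exp_le_one_add_add_sq_mul_exp_abs _).trans ?_
    have h1 : |s * c * f x| ≤ s * |f x| := by
      rw [abs_mul, abs_mul, abs_of_nonneg hs]
      have : s * |c| ≤ s := mul_le_of_le_one_right hs hc
      gcongr
    have h2 : (s * c * f x) ^ 2 ≤ s ^ 2 * f x ^ 2 := by
      rw [← sq_abs, ← mul_pow, ← sq_abs (s * f x), abs_mul s, abs_of_nonneg hs]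
      gcongr
    have h3 : (s * c * f x) ^ 2 * Real.exp |s * c * f x| ≤
        s ^ 2 * f x ^ 2 * Real.exp (s * |f x|) := by gcongr
    linarith
  have hgint : Integrable (fun x => 1 + s * c * f x + s ^ 2 * (f x ^ 2 * Real.exp (s * |f x|))) μ :=
    ((integrable_const 1).add (hf.const_mul _)).add (h_int.const_mul _)
  have hmeas : AEStronglyMeasurable (fun x => Real.exp (s * c * f x)) μ :=
    (Real.continuous_exp.comp_aestronglyMeasurable (hf.aestronglyMeasurable.const_mul _))
  have h_int' : Integrable (fun x => Real.exp (s * c * f x)) μ :=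
    hgint.mono' hmeas (ae_of_all _ fun x => by
      rw [Real.norm_eq_abs, Real.abs_exp]; exact hpt x)
  refine ⟨h_int', (integral_mono h_int' hgint hpt).trans ?_⟩
  have hlin : Integrable (fun x => 1 + s * c * f x) μ := (integrable_const 1).add (hf.const_mul _)
  rw [integral_add hlin (h_int.const_mul _),
    integral_add (integrable_const 1) (hf.const_mul _), integral_const_mul, integral_const_mul]
  simp only [integral_const, probReal_univ, one_smul]
  have h1 : s * c * ∫ x, f x ∂μ ≤ s * m := by
    rw [mul_assoc]
    refine mul_le_mul_of_nonneg_left ?_ hs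
    refine (le_abs_self _).trans ?_
    rw [abs_mul]
    exact (mul_le_of_le_one_left (abs_nonneg _) hc).trans hm
  have h2 := mul_le_mul_of_nonneg_left hB (sq_nonneg s)
  have h3 := Real.add_one_le_exp (s * m + s ^ 2 * B)
  linarith

variable {Ω : Type*} [MeasurableSpace Ω] {P : Measure Ω} [IsProbabilityMeasure P] {ξ : ℕ → Ω → ℝ}

lemma IsIID.measureReal_le_sum_le (h : IsIID P μ ξ) {f : ℝ → ℝ} (hf : Measurable f) {s b : ℝ}
    (hs : 0 ≤ s) (hb : ∀ c : ℝ, |c| ≤ 1 → Integrable (fun x => Real.exp (s * c * f x)) μ ∧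
      ∫ x, Real.exp (s * c * f x) ∂μ ≤ Real.exp b) (n : ℕ) {c : ℕ → ℝ} (hc : ∀ j, |c j| ≤ 1)
    (r : ℝ) :
    P.real {ω | r ≤ ∑ j ∈ Finset.range n, c j * f (ξ j ω)} ≤ Real.exp (n * b - s * r) := by
  have hind : iIndepFun (fun (j : Fin n) => ξ j) P := h.2.precomp Fin.val_injective
  have h1 : ∀ ω, Real.exp (s * ∑ j ∈ Finset.range n, c j * f (ξ j ω))
      = ∏ j : Fin n, (fun x : ℝ => Real.exp (s * c j * f x)) (ξ j ω) := by
    intro ω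
    rw [← Real.exp_sum, Finset.sum_range, Finset.mul_sum]
    congr 1
    exact Finset.sum_congr rfl fun j _ => by ring
  have h2 : ∫ ω, Real.exp (s * ∑ j ∈ Finset.range n, c j * f (ξ j ω)) ∂P
      = ∏ j : Fin n, ∫ x, Real.exp (s * c j * f x) ∂μ := by
    simp_rw [h1]
    rw [hind.integral_fun_prod_comp (f := fun (j : Fin n) (x : ℝ) => Real.exp (s * c j * f x))
      (fun j => (h.1 j).aemeasurable) (fun j => by fun_prop)]
    refine Finset.prod_congr rfl fun j _ => ?_
    exact (h.1 j).integral_comp (f := fun x : ℝ => Real.exp (s * c j * f x)) (by fun_prop)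
  have hpos : 0 < ∏ j : Fin n, ∫ x, Real.exp (s * c j * f x) ∂μ :=
    Finset.prod_pos fun j _ => integral_exp_pos (hb _ (hc j)).1
  -- The integral equals a product of positive numbers, hence is nonzero, which forces
  -- integrability.
  have h_int : Integrable (fun ω => Real.exp (s * ∑ j ∈ Finset.range n, c j * f (ξ j ω))) P :=
    Integrable.of_integral_ne_zero (by rw [h2]; exact hpos.ne')
  refine (measure_ge_le_exp_mul_mgf r hs h_int).trans ?_
  rw [mgf, h2, sub_eq_add_neg, add_comm, Real.exp_add, neg_mul]
  refine mul_le_mul_of_nonneg_left ?_ (Real.exp_pos _).le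
  calc _ ≤ ∏ _j : Fin n, Real.exp b :=
        Finset.prod_le_prod (fun j _ => integral_nonneg fun x => (Real.exp_pos _).le)
          fun j _ => (hb _ (hc j)).2
    _ = _ := by simp [Real.exp_nat_mul]

/-- If the norm exceeds `2r`, the real or the imaginary part exceeds `r` in absolute value; the four
directions `±1, ±i` detect this. -/
lemma IsIID.measureReal_lt_norm_dftCoeff_le (h : IsIID P μ ξ) {f : ℝ → ℝ} (hf : Measurable f)
    {s b : ℝ} (hs : 0 ≤ s) (hb : ∀ c : ℝ, |c| ≤ 1 → Integrable (fun x => Real.exp (s * c * f x)) μ ∧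
      ∫ x, Real.exp (s * c * f x) ∂μ ≤ Real.exp b) (n k : ℕ) (r : ℝ) :
    P.real {ω | 2 * r < ‖dftCoeff n (fun j => f (ξ j ω)) k‖} ≤ 4 * Real.exp (n * b - s * r) := by
  have hdir : ∀ u : ℂ, ‖u‖ = 1 → P.real {ω | r ≤ (u * dftCoeff n (fun j => f (ξ j ω)) k).re}
      ≤ Real.exp (n * b - s * r) := by
    intro u hu
    simp_rw [re_mul_dftCoeff]
    refine h.measureReal_le_sum_le hf hs hb n (fun j => ?_) r
    refine (Complex.abs_re_le_norm _).trans ?_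
    rw [norm_mul, norm_pow, norm_rootExp, hu]
    simp
  have hsub : {ω | 2 * r < ‖dftCoeff n (fun j => f (ξ j ω)) k‖} ⊆
      ({ω | r ≤ (1 * dftCoeff n (fun j => f (ξ j ω)) k).re} ∪
        {ω | r ≤ (-1 * dftCoeff n (fun j => f (ξ j ω)) k).re}) ∪
      ({ω | r ≤ (Complex.I * dftCoeff n (fun j => f (ξ j ω)) k).re} ∪
        {ω | r ≤ (-Complex.I * dftCoeff n (fun j => f (ξ j ω)) k).re}) := by
    intro ω hω
    have h1 : 2 * r < ‖dftCoeff n (fun j => f (ξ j ω)) k‖ := hω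
    have h2 := Complex.norm_le_abs_re_add_abs_im (dftCoeff n (fun j => f (ξ j ω)) k)
    simp only [Set.mem_union, Set.mem_ofPred_eq]
    generalize dftCoeff n (fun j => f (ξ j ω)) k = z at h1 h2 ⊢
    by_contra! hcon
    simp at hcon
    obtain ⟨⟨a1, a2⟩, a3, a4⟩ := hcon
    have b1 : |z.re| < r := abs_lt.2 ⟨by linarith, by linarith⟩
    have b2 : |z.im| < r := abs_lt.2 ⟨by linarith, by linarith⟩
    linarith
  refine (measureReal_mono hsub).trans ?_
  refine (measureReal_union_le _ _).trans ?_
  have h1 := measureReal_union_le (μ := P)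
    {ω | r ≤ (1 * dftCoeff n (fun j => f (ξ j ω)) k).re}
    {ω | r ≤ (-1 * dftCoeff n (fun j => f (ξ j ω)) k).re}
  have h2 := measureReal_union_le (μ := P)
    {ω | r ≤ (Complex.I * dftCoeff n (fun j => f (ξ j ω)) k).re}
    {ω | r ≤ (-Complex.I * dftCoeff n (fun j => f (ξ j ω)) k).re}
  have e1 := hdir 1 (by simp)
  have e2 := hdir (-1) (by simp)
  have e3 := hdir Complex.I (by simp)
  have e4 := hdir (-Complex.I) (by simp)
  linarith

lemma IsIID.measureReal_exists_lt_norm_dftCoeff_le (h : IsIID P μ ξ) {f : ℝ → ℝ} (hf : Measurable f)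
    {s b : ℝ} (hs : 0 ≤ s) (hb : ∀ c : ℝ, |c| ≤ 1 → Integrable (fun x => Real.exp (s * c * f x)) μ ∧
      ∫ x, Real.exp (s * c * f x) ∂μ ≤ Real.exp b) (n : ℕ) (r : ℝ) :
    P.real {ω | ∃ k ∈ Finset.range n, 2 * r < ‖dftCoeff n (fun j => f (ξ j ω)) k‖} ≤
      n * (4 * Real.exp (n * b - s * r)) := by
  have hunion : {ω | ∃ k ∈ Finset.range n, 2 * r < ‖dftCoeff n (fun j => f (ξ j ω)) k‖}
      = ⋃ k ∈ Finset.range n, {ω | 2 * r < ‖dftCoeff n (fun j => f (ξ j ω)) k‖} := by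
    ext ω; simp
  rw [hunion]
  refine (measureReal_biUnion_finset_le _ _).trans ?_
  refine (Finset.sum_le_sum fun k _ => h.measureReal_lt_norm_dftCoeff_le hf hs hb n k r).trans ?_
  simp

end

/-! ### Upper tail under exponential moments -/

section

variable {μ : Measure ℝ} [IsProbabilityMeasure μ]

/-- Upper tail of the Fourier coefficients for laws with exponential moments. -/
lemma exists_measureReal_exists_lt_norm_dftCoeff_le_of_mgf (hmgf : HasMGFNearZero μ)
    (h_int : Integrable (fun x : ℝ => x) μ) (hmean : ∫ x, x ∂μ = 0) :
    ∃ A : ℝ, 0 < A ∧ ∀ᶠ n : ℕ in atTop,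
      ∀ (Ω : Type*) [MeasurableSpace Ω] (P : Measure Ω) [IsProbabilityMeasure P] (ξ : ℕ → Ω → ℝ),
        IsIID P μ ξ →
          P.real {ω | ∃ k ∈ Finset.range n, A * (√n * √(Real.log n)) <
            ‖dftCoeff n (fun j => ξ j ω) k‖} ≤ 4 * (1 / √n) := by
  obtain ⟨a, ha, hexp⟩ := hmgf
  have hI : ∀ s : ℝ, 0 ≤ s → s ≤ a / 4 →
      Integrable (fun x : ℝ => x ^ 2 * Real.exp (s * |x|)) μ := by
    intro s hs0 hs
    have := integrable_pow_abs_mul_exp_add_of_integrable_exp_mul (X := fun x : ℝ => x) (μ := μ)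
      (v := 0) (t := a / 2) (x := s) (by simpa using hexp (a / 2) ⟨by linarith, by linarith⟩)
      (by simpa using hexp (-(a / 2)) ⟨by linarith, by linarith⟩) hs0
      (by rw [abs_of_pos (by positivity)]; linarith) 2
    simpa using this
  set B := ∫ x, x ^ 2 * Real.exp (a / 4 * |x|) ∂μ with hBdef
  have hB0 : 0 ≤ B := integral_nonneg fun x => by positivity
  have hB : ∀ s : ℝ, 0 ≤ s → s ≤ a / 4 → ∫ x, x ^ 2 * Real.exp (s * |x|) ∂μ ≤ B := by
    intro s hs0 hs
    refine integral_mono (hI s hs0 hs) (hI _ (by positivity) le_rfl) fun x => ?_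
    show x ^ 2 * Real.exp (s * |x|) ≤ x ^ 2 * Real.exp (a / 4 * |x|)
    gcongr
  refine ⟨2 * (B + 2), by positivity, ?_⟩
  have hlim : Tendsto (fun n : ℕ => √(Real.log n / n)) atTop (𝓝 0) := by
    have h1 : Tendsto (fun x : ℝ => Real.log x / x) atTop (𝓝 0) := by
      simpa using Real.isLittleO_log_id_atTop.tendsto_div_nhds_zero
    have h2 := (Real.continuous_sqrt.tendsto 0).comp (h1.comp tendsto_natCast_atTop_atTop)
    rw [Real.sqrt_zero] at h2
    exact h2
  filter_upwards [hlim.eventually_le_const (show (0 : ℝ) < a / 4 by positivity),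
    eventually_ge_atTop 1] with n hn hn1
  intro Ω _ P _ ξ h
  have hn' : (1 : ℝ) ≤ n := by exact_mod_cast hn1
  have hlog : 0 ≤ Real.log n := Real.log_nonneg hn'
  -- This makes `n s² B = B log n` and `s r = (B + 2) log n`. The Chernoff exponent is then `-2 log
  -- n`, and the union over `n` roots leaves `4/n`.
  set s := √(Real.log n / n) with hs
  have hs0 : 0 ≤ s := Real.sqrt_nonneg _
  have hs2 : s ^ 2 = Real.log n / n := Real.sq_sqrt (by positivity)
  have hss : s * (√n * √(Real.log n)) = Real.log n := by
    rw [hs, Real.sqrt_div hlog]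
    have h1 : √(n : ℝ) ≠ 0 := by positivity
    have h2 := Real.mul_self_sqrt hlog
    field_simp
    rw [sq, h2]
  have key := h.measureReal_exists_lt_norm_dftCoeff_le measurable_id hs0
    (b := s * 0 + s ^ 2 * B) (fun c hc => integrable_exp_mul_and_integral_le (f := id) h_int hs0
      (by simp [hmean]) (hI s hs0 hn) (hB s hs0 hn) hc) n ((B + 2) * (√n * √(Real.log n)))
  simp only [id_eq, ← mul_assoc] at key ⊢
  refine key.trans ?_
  have e : n * (s * 0 + s ^ 2 * B) - s * (B + 2) * √n * √(Real.log n) = -2 * Real.log n := by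
    have e1 : s * (B + 2) * √n * √(Real.log n) = (B + 2) * (s * (√n * √(Real.log n))) := by ring
    rw [e1, hss, hs2]
    field_simp
    ring
  rw [e, show -2 * Real.log n = -(Real.log n + Real.log n) by ring, Real.exp_neg, Real.exp_add,
    Real.exp_log (by positivity)]
  have h3 : √(n : ℝ) ≤ n := by
    rw [Real.sqrt_le_left (by positivity)]; nlinarith
  calc (n : ℝ) * 4 * ((n : ℝ) * n)⁻¹ = 4 * (1 / n) := by field_simp
    _ ≤ 4 * (1 / √n) := by gcongr

end

/-! ### Truncation and the upper tail under two moments -/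

lemma dftCoeff_add (n : ℕ) (x y : ℕ → ℝ) (k : ℕ) :
    dftCoeff n (fun j => x j + y j) k = dftCoeff n x k + dftCoeff n y k := by
  simp only [dftCoeff, ← Finset.sum_add_distrib]
  exact Finset.sum_congr rfl fun j _ => by push_cast; ring

lemma norm_dftCoeff_le (n : ℕ) (x : ℕ → ℝ) (k : ℕ) :
    ‖dftCoeff n x k‖ ≤ ∑ j ∈ Finset.range n, |x j| := by
  refine (norm_sum_le _ _).trans (le_of_eq (Finset.sum_congr rfl fun j _ => ?_))
  rw [norm_mul, norm_pow, norm_rootExp, Complex.norm_real, Real.norm_eq_abs]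
  simp

/-- The truncation of `x` at level `R`. -/
noncomputable def truncate (R x : ℝ) : ℝ := Set.indicator (Set.Icc (-R) R) id x

lemma measurable_truncate (R : ℝ) : Measurable (truncate R) :=
  measurable_id.indicator measurableSet_Icc

lemma truncate_of_abs_le {R x : ℝ} (h : |x| ≤ R) : truncate R x = x :=
  Set.indicator_of_mem (s := Set.Icc (-R) R) (abs_le.1 h) id

lemma truncate_of_lt_abs {R x : ℝ} (h : R < |x|) : truncate R x = 0 :=
  Set.indicator_of_notMem (s := Set.Icc (-R) R) (fun hx => h.not_ge (abs_le.2 hx)) id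

lemma abs_truncate_le {R : ℝ} (hR : 0 ≤ R) (x : ℝ) : |truncate R x| ≤ R := by
  rcases le_or_gt |x| R with h | h
  · rwa [truncate_of_abs_le h]
  · rw [truncate_of_lt_abs h]; simpa

lemma truncate_sq_le (R x : ℝ) : truncate R x ^ 2 ≤ x ^ 2 := by
  rcases le_or_gt |x| R with h | h
  · rw [truncate_of_abs_le h]
  · rw [truncate_of_lt_abs h]; simpa using sq_nonneg x

lemma abs_sub_truncate_le {R : ℝ} (hR : 0 < R) (x : ℝ) : |x - truncate R x| ≤ x ^ 2 / R := by
  rcases le_or_gt |x| R with h | h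
  · rw [truncate_of_abs_le h, sub_self, abs_zero]; positivity
  · rw [truncate_of_lt_abs h, sub_zero, le_div_iff₀ hR, ← sq_abs, sq]
    exact mul_le_mul_of_nonneg_left h.le (abs_nonneg x)

section

variable {μ : Measure ℝ} [IsProbabilityMeasure μ]

lemma integrable_truncate (R : ℝ) (hR : 0 ≤ R) : Integrable (truncate R) μ :=
  Integrable.of_bound (measurable_truncate R).aestronglyMeasurable R
    (ae_of_all _ fun x => abs_truncate_le hR x)

lemma integral_abs_sub_truncate_le (h2 : MemLp (fun x : ℝ => x) 2 μ) {R : ℝ} (hR : 0 < R) :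
    ∫ x, |x - truncate R x| ∂μ ≤ (∫ x, x ^ 2 ∂μ) / R := by
  rw [← integral_div]
  refine integral_mono ((h2.integrable (by norm_num)).sub (integrable_truncate R hR.le)).abs
    (h2.integrable_sq.div_const R) fun x => abs_sub_truncate_le hR x

/-- Upper tail of the Fourier coefficients for laws with finite second moment. -/
lemma exists_measureReal_exists_lt_norm_dftCoeff_le (h2 : MemLp (fun x : ℝ => x) 2 μ)
    (hmean : ∫ x, x ∂μ = 0) :
    ∃ C : ℝ, 0 < C ∧ ∀ᶠ n : ℕ in atTop,
      ∀ (Ω : Type*) [MeasurableSpace Ω] (P : Measure Ω) [IsProbabilityMeasure P] (ξ : ℕ → Ω → ℝ),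
        IsIID P μ ξ →
          P.real {ω | ∃ k ∈ Finset.range n, 3 * (√n * Real.log n) <
            ‖dftCoeff n (fun j => ξ j ω) k‖} ≤ C * (1 / Real.log n) := by
  set V := ∫ x, x ^ 2 ∂μ with hV
  have hV0 : 0 ≤ V := integral_nonneg fun x => sq_nonneg x
  have h_int : Integrable (fun x : ℝ => x) μ := h2.integrable (by norm_num)
  -- With truncation level `R = √n` and Chernoff parameter `3/R`, the terms from the truncated mean
  -- (at most `V/R`) and the second moment total `K`, independently of `n`.
  set K := 3 * V + 9 * (V * Real.exp 3) with hK
  refine ⟨4 * Real.exp K + V, by positivity, ?_⟩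
  filter_upwards [eventually_ge_atTop 3] with n hn3
  intro Ω _ P _ ξ h
  have hn' : (3 : ℝ) ≤ n := by exact_mod_cast hn3
  have hn0 : (0 : ℝ) < n := by linarith
  have hlog : 0 < Real.log n := Real.log_pos (by linarith)
  set R := √(n : ℝ) with hR
  have hR0 : 0 < R := Real.sqrt_pos.2 hn0
  have hR2 : R * R = n := Real.mul_self_sqrt hn0.le
  set B₁ := {ω | ∃ k ∈ Finset.range n,
    2 * (R * Real.log n) < ‖dftCoeff n (fun j => truncate R (ξ j ω)) k‖}
  set B₂ := {ω | R * Real.log n ≤ ∑ j ∈ Finset.range n, |ξ j ω - truncate R (ξ j ω)|}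
  have hsub : {ω | ∃ k ∈ Finset.range n, 3 * (R * Real.log n) <
      -- The factor `3` splits as `2` for the truncated part and `1` for the remainder, which is
      -- bounded by its `ℓ¹` norm simultaneously for all `k`.
      ‖dftCoeff n (fun j => ξ j ω) k‖} ⊆ B₁ ∪ B₂ := by
    rintro ω ⟨k, hk, hω⟩
    by_contra hcon
    simp only [B₁, B₂, Set.mem_union, Set.mem_ofPred_eq, not_or, not_exists, not_and, not_lt,
      not_le] at hcon
    have e : dftCoeff n (fun j => ξ j ω) k = dftCoeff n (fun j => truncate R (ξ j ω)) k
        + dftCoeff n (fun j => ξ j ω - truncate R (ξ j ω)) k := by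
      rw [← dftCoeff_add]; simp
    rw [e] at hω
    have h1 := norm_add_le (dftCoeff n (fun j => truncate R (ξ j ω)) k)
      (dftCoeff n (fun j => ξ j ω - truncate R (ξ j ω)) k)
    have h3 := norm_dftCoeff_le n (fun j => ξ j ω - truncate R (ξ j ω)) k
    linarith [hcon.1 k hk, hcon.2]
  have hB₁ : P.real B₁ ≤ 4 * Real.exp K * (1 / Real.log n) := by
    have hmeanT : |∫ x, truncate R x ∂μ| ≤ V / R := by
      have e : ∫ x, truncate R x ∂μ = -∫ x, (x - truncate R x) ∂μ := by
        rw [integral_sub h_int (integrable_truncate R hR0.le), hmean]; ring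
      rw [e, abs_neg]
      exact abs_integral_le_integral_abs.trans (integral_abs_sub_truncate_le h2 hR0)
    have hs0 : 0 ≤ 3 / R := by positivity
    have hpt : ∀ x, truncate R x ^ 2 * Real.exp (3 / R * |truncate R x|) ≤ x ^ 2 * Real.exp 3 := by
      intro x
      have e1 := truncate_sq_le R x
      have e2 : 3 / R * |truncate R x| ≤ 3 := by
        calc _ ≤ 3 / R * R := by gcongr; exact abs_truncate_le hR0.le x
          _ = 3 := by field_simp
      gcongr
    have hmeas := measurable_truncate R
    have hintT : Integrable (fun x => truncate R x ^ 2 * Real.exp (3 / R * |truncate R x|)) μ := by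
      refine (h2.integrable_sq.mul_const (Real.exp 3)).mono' (by fun_prop) (ae_of_all _ fun x => ?_)
      rw [Real.norm_eq_abs, abs_of_nonneg (by positivity)]
      exact hpt x
    have hBT : ∫ x, truncate R x ^ 2 * Real.exp (3 / R * |truncate R x|) ∂μ ≤ V * Real.exp 3 := by
      rw [hV, ← integral_mul_const]
      exact integral_mono hintT (h2.integrable_sq.mul_const _) hpt
    have key := h.measureReal_exists_lt_norm_dftCoeff_le hmeas hs0
      (b := 3 / R * (V / R) + (3 / R) ^ 2 * (V * Real.exp 3))
      (fun c hc => integrable_exp_mul_and_integral_le (integrable_truncate R hR0.le) hs0 hmeanT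
        hintT hBT hc) n (R * Real.log n)
    refine key.trans ?_
    have e : n * (3 / R * (V / R) + (3 / R) ^ 2 * (V * Real.exp 3)) - 3 / R * (R * Real.log n)
        = K + -(3 * Real.log n) := by
      rw [hK, ← hR2]
      field_simp
      ring
    have e3 : Real.exp (-(3 * Real.log n)) = ((n : ℝ) ^ 3)⁻¹ := by
      rw [Real.exp_neg]
      congr 1
      rw [show (3 : ℝ) * Real.log n = ((3 : ℕ) : ℝ) * Real.log n by norm_num, Real.exp_nat_mul,
        Real.exp_log hn0]
    rw [e, Real.exp_add, e3]
    have hln : Real.log n ≤ (n : ℝ) ^ 2 := by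
      have := Real.log_le_sub_one_of_pos hn0
      nlinarith
    calc n * (4 * (Real.exp K * ((n : ℝ) ^ 3)⁻¹)) = 4 * Real.exp K * (1 / (n : ℝ) ^ 2) := by
          field_simp
      _ ≤ _ := by gcongr
  have hB₂ : P.real B₂ ≤ V * (1 / Real.log n) := by
    have hmeas := measurable_truncate R
    have hintj : ∀ j, Integrable (fun ω => |ξ j ω - truncate R (ξ j ω)|) P := by
      intro j
      have h1 : Integrable (fun x => |x - truncate R x|) (P.map (ξ j)) := by
        rw [(h.1 j).map_eq]; exact (h_int.sub (integrable_truncate R hR0.le)).abs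
      exact h1.comp_aemeasurable (h.1 j).aemeasurable
    have hEj : ∀ j, ∫ ω, |ξ j ω - truncate R (ξ j ω)| ∂P ≤ V / R := by
      intro j
      refine le_trans (le_of_eq ?_) (integral_abs_sub_truncate_le h2 hR0)
      exact (h.1 j).integral_comp (f := fun x => |x - truncate R x|)
        (by fun_prop)
    have hm := mul_meas_ge_le_integral_of_nonneg (μ := P)
      (f := fun ω => ∑ j ∈ Finset.range n, |ξ j ω - truncate R (ξ j ω)|)
      (ae_of_all _ fun ω => Finset.sum_nonneg fun j _ => abs_nonneg _)
      (integrable_finsetSum _ fun j _ => hintj j) (R * Real.log n)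
    rw [integral_finsetSum _ fun j _ => hintj j] at hm
    -- Each remainder has mean at most `V/√n`, so the total is `V √n`; Markov at level `√n log n`
    -- yields `V / log n`.
    have hsum : ∑ j ∈ Finset.range n, ∫ ω, |ξ j ω - truncate R (ξ j ω)| ∂P ≤ V * R := by
      calc _ ≤ ∑ _j ∈ Finset.range n, V / R := Finset.sum_le_sum fun j _ => hEj j
        _ = n * (V / R) := by simp
        _ = V * R := by rw [← hR2]; field_simp
    have hfin := hm.trans hsum
    rw [mul_one_div, le_div_iff₀ hlog]
    have h5 : R * (P.real B₂ * Real.log n) ≤ R * V := by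
      calc R * (P.real B₂ * Real.log n) = R * Real.log n * P.real B₂ := by ring
        _ ≤ V * R := hfin
        _ = R * V := by ring
    exact le_of_mul_le_mul_left h5 hR0
  refine (measureReal_mono hsub).trans ((measureReal_union_le _ _).trans ?_)
  linarith

end

/-! ### Combining the two tails -/

lemma one_sub_le_measureReal_conditionNumber_le {Ω : Type*} [MeasurableSpace Ω] (P : Measure Ω)
    [IsProbabilityMeasure P] (ξ : ℕ → Ω → ℝ) {n : ℕ} (hn : n ≠ 0) {a b : ℝ} (ha : 0 < a)
    (hb : 0 ≤ b) :
    1 - (P.real {ω | ∃ k ∈ Finset.range n, ‖dftCoeff n (fun j => ξ j ω) k‖ < a}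
      + P.real {ω | ∃ k ∈ Finset.range n, b < ‖dftCoeff n (fun j => ξ j ω) k‖}) ≤
      P.real {ω | conditionNumber (circulantMatrix n (fun j => ξ j ω)) ≤ ENNReal.ofReal (b / a)} := by
  set A := {ω | ∃ k ∈ Finset.range n, ‖dftCoeff n (fun j => ξ j ω) k‖ < a}
  set B := {ω | ∃ k ∈ Finset.range n, b < ‖dftCoeff n (fun j => ξ j ω) k‖}
  set S := {ω | conditionNumber (circulantMatrix n (fun j => ξ j ω)) ≤ ENNReal.ofReal (b / a)}
  -- Covering and subadditivity replace complements, so no measurability of these events is needed.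
  have hcover : (Set.univ : Set Ω) ⊆ S ∪ (A ∪ B) := by
    intro ω _
    by_cases h : ω ∈ A ∪ B
    · exact Or.inr h
    · refine Or.inl (conditionNumber_circulantMatrix_le hn _ ha hb fun k hk => ?_)
      simp only [A, B, Set.mem_union, Set.mem_ofPred_eq, not_or, not_exists, not_and, not_lt] at h
      exact ⟨h.1 k hk, h.2 k hk⟩
  have h1 := measureReal_mono (μ := P) hcover
  have h2 := measureReal_union_le (μ := P) S (A ∪ B)
  have h3 := measureReal_union_le (μ := P) A B
  rw [probReal_univ] at h1
  linarith

theorem mainTheorem1 (μ : Measure ℝ) [IsProbabilityMeasure μ]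
    (hH : ConditionH μ) (h2 : MemLp (fun x : ℝ => x) 2 μ) (hmean : ∫ x, x ∂μ = 0) :
    (0 < variance (fun x : ℝ => x) μ → HasMGFNearZero μ →
      ∃ C₀ C₁ : ℝ, 0 < C₀ ∧ 0 < C₁ ∧ ∃ δ : ℕ → ℝ, Tendsto δ atTop (𝓝 0) ∧
        ∀ ε : ℝ, 0 < ε → ∀ ρ ∈ Set.Ioo (0 : ℝ) (1 / 4), ∀ᶠ n : ℕ in atTop,
          ∀ (Ω : Type*) [MeasurableSpace Ω] (P : Measure Ω) [IsProbabilityMeasure P]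
            (ξ : ℕ → Ω → ℝ), IsIID P μ ξ →
            1 - C₁ * ((ε ^ 2 + ε) * (n : ℝ) ^ (-2 * ρ) + (n : ℝ) ^ (-1 / 2 + δ n)) ≤
              P.real {ω | conditionNumber (circulantMatrix n (fun j => ξ j ω)) ≤
                ENNReal.ofReal
                  (C₀ / ε * (n : ℝ) ^ (ρ + 1 / 2) * (Real.log n) ^ (1 / 2 : ℝ))}) ∧
    (∃ C₀ C₂ : ℝ, 0 < C₀ ∧ 0 < C₂ ∧
        ∀ ε : ℝ, 0 < ε → ∀ ρ ∈ Set.Ioo (0 : ℝ) (1 / 4), ∀ᶠ n : ℕ in atTop,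
          ∀ (Ω : Type*) [MeasurableSpace Ω] (P : Measure Ω) [IsProbabilityMeasure P]
            (ξ : ℕ → Ω → ℝ), IsIID P μ ξ →
            1 - C₂ * ((ε ^ 2 + ε) * (n : ℝ) ^ (-2 * ρ) + (Real.log n) ^ (-1 / 2 : ℝ)) ≤
              P.real {ω | conditionNumber (circulantMatrix n (fun j => ξ j ω)) ≤
                ENNReal.ofReal (C₀ / ε * (n : ℝ) ^ (ρ + 1 / 2) * Real.log n)}) := by
  have hsq : ∀ {n : ℕ} (ε ρ : ℝ), (ε * (n : ℝ) ^ (-ρ)) ^ 2 = ε ^ 2 * (n : ℝ) ^ (-2 * ρ) := by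
    intro n ε ρ
    rw [mul_pow, ← Real.rpow_natCast ((n : ℝ) ^ (-ρ)), ← Real.rpow_mul (by positivity)]
    congr 2
    push_cast
    ring
  have hratio : ∀ {n : ℕ} (ε ρ A l : ℝ), 0 < ε → (0 : ℝ) < n →
      A * (√n * l) / (ε * (n : ℝ) ^ (-ρ)) = A / ε * (n : ℝ) ^ (ρ + 1 / 2) * l := by
    intro n ε ρ A l hε hn
    rw [Real.rpow_neg hn.le, Real.rpow_add hn, Real.sqrt_eq_rpow]
    have : (n : ℝ) ^ ρ ≠ 0 := (Real.rpow_pos_of_pos hn ρ).ne'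
    field_simp
  constructor
  · intro _ hmgf
    obtain ⟨C, hC, hlow⟩ := exists_measureReal_exists_norm_dftCoeff_lt_le hH
    obtain ⟨A, hA, hup⟩ := exists_measureReal_exists_lt_norm_dftCoeff_le_of_mgf hmgf
      (h2.integrable (by norm_num)) hmean
    -- The errors are `C (ε² n^(-2ρ) + n^(-1/2))` from below and `4 n^(-1/2)` from above, so `δ = 0`
    -- works.
    refine ⟨A, C + 4, hA, by positivity, fun _ => 0, tendsto_const_nhds, ?_⟩
    intro ε hε ρ hρ
    filter_upwards [hup, eventually_ge_atTop 1] with n hn hn1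
    intro Ω _ P _ ξ h
    have hn0 : (0 : ℝ) < n := by exact_mod_cast hn1
    have hnr : 0 < (n : ℝ) ^ (-2 * ρ) := Real.rpow_pos_of_pos hn0 _
    have hmain := one_sub_le_measureReal_conditionNumber_le P ξ (n := n) (by omega)
      (a := ε * (n : ℝ) ^ (-ρ)) (b := A * (√n * √(Real.log n)))
      (mul_pos hε (Real.rpow_pos_of_pos hn0 _)) (by positivity)
    rw [hratio ε ρ A _ hε hn0, Real.sqrt_eq_rpow (Real.log n)] at hmain
    refine le_trans ?_ hmain
    have h3 := hlow Ω P ξ h n (by omega) (ε * (n : ℝ) ^ (-ρ))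
      (mul_pos hε (Real.rpow_pos_of_pos hn0 _))
    have h4 := hn Ω P ξ h
    rw [Real.sqrt_eq_rpow (Real.log n)] at h4
    rw [hsq] at h3
    have e : (n : ℝ) ^ (-1 / 2 + (0 : ℝ)) = 1 / √n := by
      rw [add_zero, neg_div, Real.rpow_neg hn0.le, ← Real.sqrt_eq_rpow, one_div]
    rw [e]
    set x := (n : ℝ) ^ (-2 * ρ)
    set y := 1 / √(n : ℝ)
    have hy : 0 ≤ y := by positivity
    have : 0 ≤ C * (ε * x) + 4 * ((ε ^ 2 + ε) * x) := by positivity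
    linarith
  · obtain ⟨C, hC, hlow⟩ := exists_measureReal_exists_norm_dftCoeff_lt_le hH
    obtain ⟨C', hC', hup⟩ := exists_measureReal_exists_lt_norm_dftCoeff_le h2 hmean
    refine ⟨3, C + C', by norm_num, by positivity, ?_⟩
    intro ε hε ρ hρ
    filter_upwards [hup, eventually_ge_atTop 3] with n hn hn3
    intro Ω _ P _ ξ h
    have hn3' : (3 : ℝ) ≤ n := by exact_mod_cast hn3
    have hn0 : (0 : ℝ) < n := by linarith
    have hlog1 : 1 ≤ Real.log n := by
      rw [Real.le_log_iff_exp_le hn0]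
      linarith [Real.exp_one_lt_d9]
    have hnr : 0 < (n : ℝ) ^ (-2 * ρ) := Real.rpow_pos_of_pos hn0 _
    have hmain := one_sub_le_measureReal_conditionNumber_le P ξ (n := n) (by omega)
      (a := ε * (n : ℝ) ^ (-ρ)) (b := 3 * (√n * Real.log n))
      (mul_pos hε (Real.rpow_pos_of_pos hn0 _)) (by positivity)
    rw [hratio ε ρ 3 _ hε hn0] at hmain
    refine le_trans ?_ hmain
    have h3 := hlow Ω P ξ h n (by omega) (ε * (n : ℝ) ^ (-ρ))
      (mul_pos hε (Real.rpow_pos_of_pos hn0 _))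
    have h4 := hn Ω P ξ h
    rw [hsq] at h3
    have e : (Real.log n) ^ (-1 / 2 : ℝ) = 1 / √(Real.log n) := by
      rw [neg_div, Real.rpow_neg (by linarith), ← Real.sqrt_eq_rpow, one_div]
    have hs : 0 < √(Real.log n) := Real.sqrt_pos.2 (by linarith)
    -- Both `n^(-1/2)` and `1 / log n` are absorbed in `(log n)^(-1/2)`; the latter uses `log n ≥
    -- 1`, hence `n ≥ 3`.
    have e1 : 1 / √(n : ℝ) ≤ 1 / √(Real.log n) := by
      gcongr
      linarith [Real.log_le_sub_one_of_pos hn0]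
    have e2 : 1 / Real.log n ≤ 1 / √(Real.log n) := by
      gcongr
      rw [Real.sqrt_le_left (by linarith)]
      nlinarith
    rw [e]
    set x := (n : ℝ) ^ (-2 * ρ)
    set y := 1 / √(Real.log n)
    have h5 := mul_le_mul_of_nonneg_left e1 hC.le
    have h6 := mul_le_mul_of_nonneg_left e2 hC'.le
    have : 0 ≤ C * (ε * x) + C' * ((ε ^ 2 + ε) * x) := by positivity
    linarith
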